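/- Let $W$ be Gaussian white noise on $\mathbb{R}^2$ over a probability space $(\Omega,\mathcal F,\mathbb P)$: a family of random variables $W(A)\sim\mathcal N(0,\lambda(A))$, indexed by the Borel sets $A$ of finite Lebesgue measure $\lambda(A)$, such that for pairwise disjoint Borel sets $A_1,A_2,\dots$ with $\lambda(\bigcup_n A_n)<\infty$ the variables $W(A_n)$ are independent and $W(\bigcup_n A_n)=\sum_n W(A_n)$ almost surely. Let $\sigma=(\sigma_{\mathbf s})_{\mathbf s\in\mathbb{R}^2}$ be a jointly measurable real random field with $\mathbb E[\sigma_{\mathbf s}^2]<\infty$ for all $\mathbf s$ that is covariance stationary: $\mathbb E[\sigma_{\mathbf s}]$ does not depend on $\mathbf s$, and $\mathrm{cov}(\sigma_{\mathbf s+\mathbf r},\sigma_{\mathbf s})=\mathrm{cov}(\sigma_{\mathbf r},\sigma_0)$ for all $\mathbf s,\mathbf r$. Assume that $\sigma$ and $W$ are independent. Let $\|\cdot\|$ be the Euclidean norm, $\alpha\in(-1,0)$, and $g(\mathbf t)=\widetilde g(\|\mathbf t\|)$ with $\widetilde g(x)=x^\alpha L(x)$, where $L:(0,\infty)\to(0,\infty)$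 is continuously differentiable and slowly varying at $0$, i.e. $\lim_{x\downarrow0}L(\delta x)/L(x)=1$ for every $\delta>0$, and - $L$ is bounded away from $0$ on $(u,\sqrt2]$ for every $u>0$; - $\widetilde g(x)=\mathcal O(x^\beta)$ as $x\to\infty$ for some $\beta<-1$; - $M>0$ is such that $|\widetilde g'|$ is decreasing on $[M,\infty)$, and $\int_1^\infty\widetilde g'(r)^2\,r\,dr<\infty$; - there is $C>0$ with $|L'(x)|<C(1+x^{-1})$ for all $x\in(0,1]$. Let $X_{\mathbf t}=\int_{\mathbb{R}^2}g(\mathbf t-\mathbf s)\,\sigma_{\mathbf s}\,W(d\mathbf s)$, $\mathbf t\in\mathbb{R}^2$, the integral being the $L^2(\mathbb P)$-limit of the integrals of simple $\sigma$-measurable integrands that converge in $L^2(d\mathbf s\otimes\mathbb P)$. (i) Assume moreover that $L$ is bounded away from $0$ on $(0,1]$. Then $\mathbb E[(X_0-X_{\mathbf t})^2]$ is finite and depends on $\mathbf t$ only through $h=\|\mathbf t\|$, and, writing $V(h)$ for its value, for every vector $\mathbf e$ with $\|\mathbf e\|=1$, \[h^{-2-2\alpha}\,L(h)^{-2}\,V(h)\;\longrightarrow\;\mathbb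 E[\sigma_0^2]\int_{\mathbb{R}^2}\big(\|\mathbf x+\mathbf e/2\|^\alpha-\|\mathbf x-\mathbf e/2\|^\alpha\big)^2\,d\mathbf x<\infty\qquad\text{as } h\downarrow0.\] (ii) If $B=\{\mathbf s:\|\mathbf s-\mathbf c\|\le M+1\}$ is a closed ball of radius $M+1$ with $\sup_{\mathbf s\in B}\sigma_{\mathbf s}^2<\infty$ almost surely, then for every $\varepsilon\in(0,\alpha+1)$ the field $X$ has a version all of whose realisations are locally $(\alpha+1-\varepsilon)$-Hölder continuous on the interior of $B$. If this boundedness holds for every ball of radius $M+1$, then for every $\varepsilon\in(0,\alpha+1)$ the field $X$ has a version all of whose realisations are locally $(\alpha+1-\varepsilon)$-Hölder continuous on $\mathbb{R}^2$. -/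

import Mathlib

open MeasureTheory ProbabilityTheory Filter Topology Set Asymptotics
open scoped ENNReal NNReal

namespace VMMA

/-- The plane with its Euclidean norm; `volume` is Lebesgue measure. -/
abbrev Plane : Type := EuclideanSpace ℝ (Fin 2)

/-- The Borel sets of finite Lebesgue measure. -/
def IsFinBorel (A : Set Plane) : Prop := MeasurableSet A ∧ volume A < ∞

/-- The kernel profile `x ↦ x ^ α * L x`, used for `x > 0`. -/
noncomputable def profile (α : ℝ) (L : ℝ → ℝ) (x : ℝ) : ℝ := x ^ α * L x

/-- The radial kernel `t ↦ ‖t‖ ^ α * L ‖t‖`; its value at the origin is immaterial. -/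
noncomputable def kernel (α : ℝ) (L : ℝ → ℝ) (t : Plane) : ℝ := profile α L ‖t‖

/-- Slow variation at `0`. -/
def SlowlyVaryingAtZero (L : ℝ → ℝ) : Prop :=
  ∀ δ : ℝ, 0 < δ → Tendsto (fun x : ℝ => L (δ * x) / L x) (𝓝[>] 0) (𝓝 1)

/-- The assumptions on the kernel. Only the values of `L` on `(0, ∞)` matter. -/
structure KernelAssumptions (α : ℝ) (L : ℝ → ℝ) (M : ℝ) : Prop where
  neg_one_lt : -1 < α
  lt_zero : α < 0
  pos : ∀ x : ℝ, 0 < x → 0 < L x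
  slowlyVarying : SlowlyVaryingAtZero L
  contDiffOn : ContDiffOn ℝ 1 L (Ioi 0)
  bounded_away : ∀ u : ℝ, 0 < u → ∃ c : ℝ, 0 < c ∧ ∀ x ∈ Ioc u (Real.sqrt 2), c ≤ L x
  decay : ∃ β : ℝ, β < -1 ∧ profile α L =O[atTop] fun x : ℝ => x ^ β
  M_pos : 0 < M
  antitone_deriv : AntitoneOn (fun x : ℝ => |deriv (profile α L) x|) (Ici M)
  integrable_deriv : IntegrableOn (fun r : ℝ => (deriv (profile α L) r) ^ 2 * r) (Ioi 1)
  deriv_bound : ∃ C : ℝ, 0 < C ∧ ∀ x ∈ Ioc (0 : ℝ) 1, |deriv L x| < C * (1 + x⁻¹)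

section Probability

variable {Ω : Type*} [MeasurableSpace Ω]

/-- Gaussian white noise on the plane. Only the values `W A` with `A` Borel of finite Lebesgue
measure matter. The series converges almost surely as an ordered series (it need not converge
absolutely). -/
structure IsWhiteNoise (P : Measure Ω) (W : Set Plane → Ω → ℝ) : Prop where
  measurable : ∀ A : Set Plane, IsFinBorel A → Measurable (W A)
  law : ∀ A : Set Plane, IsFinBorel A → P.map (W A) = gaussianReal 0 (volume A).toNNReal
  indep : ∀ A : ℕ → Set Plane, (∀ n, MeasurableSet (A n)) → Pairwise (Function.onFun Disjoint A) →
    volume (⋃ n, A n) < ∞ → iIndepFun (fun n => W (A n)) P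
  sigma_additive : ∀ A : ℕ → Set Plane, (∀ n, MeasurableSet (A n)) →
    Pairwise (Function.onFun Disjoint A) → volume (⋃ n, A n) < ∞ →
    ∀ᵐ ω ∂P, Tendsto (fun N : ℕ => ∑ n ∈ Finset.range N, W (A n) ω) atTop
      (𝓝 (W (⋃ n, A n) ω))

/-- The volatility: a jointly measurable, square integrable, covariance stationary field. -/
structure IsVolatility (P : Measure Ω) (σ : Plane → Ω → ℝ) : Prop where
  measurable : Measurable (Function.uncurry σ)
  memLp : ∀ s : Plane, MemLp (σ s) 2 P
  mean : ∀ s : Plane, ∫ ω, σ s ω ∂P = ∫ ω, σ 0 ω ∂P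
  cov : ∀ s r : Plane, covariance (σ (s + r)) (σ s) P = covariance (σ r) (σ 0) P

/-- The sigma-algebra generated by a random field. -/
@[reducible] def fieldSigma (σ : Plane → Ω → ℝ) : MeasurableSpace Ω :=
  MeasurableSpace.comap (fun ω (s : Plane) => σ s ω) MeasurableSpace.pi

/-- Independence of the volatility field and the white noise (as families of variables). -/
def IndepVolNoise (P : Measure Ω) (σ : Plane → Ω → ℝ) (W : Set Plane → Ω → ℝ) : Prop :=
  IndepFun (fun ω (s : Plane) => σ s ω) (fun ω (A : {A : Set Plane // IsFinBorel A}) => W A ω) P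

/-- A simple random integrand `∑ i, coef i * 1_{set i}` whose coefficients are square integrable
and measurable with respect to the sub-sigma-algebra `𝒢`. -/
structure SimpleIntegrand {Ω : Type*} (𝒢 : MeasurableSpace Ω) [MeasurableSpace Ω]
    (P : Measure Ω) where
  n : ℕ
  set : Fin n → Set Plane
  coef : Fin n → Ω → ℝ
  finBorel : ∀ i, IsFinBorel (set i)
  measurable : ∀ i, Measurable[𝒢] (coef i)
  memLp : ∀ i, MemLp (coef i) 2 P

/-- A simple integrand as a random field. -/
noncomputable def SimpleIntegrand.eval {Ω : Type*} {𝒢 : MeasurableSpace Ω} [MeasurableSpace Ω]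
    {P : Measure Ω} (H : SimpleIntegrand 𝒢 P) (s : Plane) (ω : Ω) : ℝ :=
  ∑ i, (H.set i).indicator (fun _ => H.coef i ω) s

/-- The elementary stochastic integral `∑ i, coef i * W (set i)` of a simple integrand. -/
noncomputable def SimpleIntegrand.integral {Ω : Type*} {𝒢 : MeasurableSpace Ω} [MeasurableSpace Ω]
    {P : Measure Ω} (H : SimpleIntegrand 𝒢 P) (W : Set Plane → Ω → ℝ) (ω : Ω) : ℝ :=
  ∑ i, H.coef i ω * W (H.set i) ω

/-- `Y` is (a representative of) the stochastic integral `∫ H_s W(ds)`: the limit in `L²(P)` of the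
elementary integrals of simple `𝒢`-integrands that converge to `H` in `L²(ds ⊗ P)`. If `𝒢` is
independent of the white noise `W`, the Itô isometry makes `Y` almost surely unique. -/
def IsStochasticIntegral {Ω : Type*} (𝒢 : MeasurableSpace Ω) [MeasurableSpace Ω] (P : Measure Ω)
    (W : Set Plane → Ω → ℝ) (H : Plane → Ω → ℝ) (Y : Ω → ℝ) : Prop :=
  Measurable Y ∧ ∃ S : ℕ → SimpleIntegrand 𝒢 P,
    Tendsto (fun k => ∫⁻ ω, ∫⁻ s, ‖(S k).eval s ω - H s ω‖ₑ ^ 2 ∂volume ∂P) atTop (𝓝 0) ∧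
    Tendsto (fun k => ∫⁻ ω, ‖(S k).integral W ω - Y ω‖ₑ ^ 2 ∂P) atTop (𝓝 0)

/-- `X` is the volatility modulated moving average `X_t = ∫ g (t - s) σ_s W(ds)`. -/
def IsVMMA (P : Measure Ω) (W : Set Plane → Ω → ℝ) (σ : Plane → Ω → ℝ) (g : Plane → ℝ)
    (X : Plane → Ω → ℝ) : Prop :=
  ∀ t : Plane, IsStochasticIntegral (fieldSigma σ) P W (fun s ω => g (t - s) * σ s ω) (X t)

/-- `Y` is a version (modification) of the random field `X`. -/
def IsVersion (P : Measure Ω) (X Y : Plane → Ω → ℝ) : Prop :=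
  ∀ t : Plane, Measurable (Y t) ∧ Y t =ᵐ[P] X t

/-- Almost surely, `σ²` is bounded on the set `B`. -/
def AEBoundedOn (P : Measure Ω) (σ : Plane → Ω → ℝ) (B : Set Plane) : Prop :=
  ∀ᵐ ω ∂P, BddAbove ((fun s => (σ s ω) ^ 2) '' B)

end Probability

/-- Local Hölder continuity of order `γ` on the set `U` (used for `γ > 0` and `U` open). -/
def LocallyHolderOn (γ : ℝ) (f : Plane → ℝ) (U : Set Plane) : Prop :=
  ∀ x ∈ U, ∃ C : ℝ≥0, ∃ V ∈ 𝓝[U] x, HolderOnWith C γ.toNNReal f V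

end VMMA

/-! Conditionally on the volatility, a stochastic integral of `H` is centred Gaussian with variance
`V = ∫ H_s² ds`; both parts rest on this, in a form that avoids conditional expectations. For a
simple integrand, cutting the sets into disjoint atoms gives the Gaussian law of the integral with
frozen coefficients, and independence of `σ` and `W` lets Fubini freeze them
(`SimpleIntegrand.lintegral_integral_pow_mul`). In the `L²` limit one obtains the isometry and, by
Fatou, `E[Y^(2m) / (v + V)^m] ≤ E[N^(2m)]` with `N` standard normal
(`IsStochasticIntegral.lintegral_pow_div_le`). The weight is essential: `σ` has only two moments, so
high moments of `Y` may be infinite.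

For (i), `E[σ_s²]` is constant in `s`, so the variogram is `E[σ_0²]` times the squared `L²` norm of
the increment of `g`, `kernelIncrement`, which by reflection invariance depends on `‖t‖` only. Put
the two singularities at `±(h/2)e` and rescale by `h` inside the unit ball. There slow variation
gives pointwise convergence, and `|L'(x)| ≤ C/x` together with the lower bound on `L` bounds
`L(hy)/L(h)` by powers of `y`, which supplies an integrable dominating function. Away from the
singularities the mean value theorem gives `O(h²)`, negligible against `h^(2+2α) L(h)²` because `α <
0`.

For (ii), no lower bound on `L` is available, but cruder power bounds still give `kernelIncrement t
= O(‖t‖^(2γ))` for every `0 < γ < α + 1`. Split the conditional variance of `X_t - X_t'` at the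
ball: inside, `σ²` is bounded and this estimate applies; outside, the kernel is smooth and the
contribution is `‖t - t'‖²` times a variable of finite mean. Hence the conditional variance is at
most `K ‖t - t'‖^(2γ')` with a random `K` (`ae_condVariance_le`). Kolmogorov's argument, run on the
events where the conditional variance is below a deterministic level, then gives Hölder continuity
on dyadic points, and the limit along dyadic approximations is the desired version
(`ae_dyadicHolder`, `exists_version`). -/

namespace VMMA

/-! ### White noise on finite families of sets: reduction to disjoint atoms. -/

section Noise

variable {Ω : Type*} [MeasurableSpace Ω] {P : Measure Ω} {W : Set Plane → Ω → ℝ}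

lemma isFinBorel_empty : IsFinBorel ∅ := ⟨MeasurableSet.empty, by simp⟩

lemma IsWhiteNoise.ae_empty (hW : IsWhiteNoise P W) : ∀ᵐ ω ∂P, W ∅ ω = 0 := by
  have h := hW.law ∅ isFinBorel_empty
  have h2 : ∀ᵐ x ∂(P.map (W ∅)), x = 0 := by
    rw [h]; simp [gaussianReal_zero_var, ae_dirac_eq]
  exact ae_of_ae_map (hW.measurable ∅ isFinBorel_empty).aemeasurable h2

lemma isFinBorel_iUnion {ι : Type*} [Fintype ι] {A : ι → Set Plane} (hA : ∀ i, IsFinBorel (A i)) :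
    IsFinBorel (⋃ i, A i) := by
  refine ⟨MeasurableSet.iUnion fun i => (hA i).1, ?_⟩
  refine (measure_iUnion_fintype_le _ _).trans_lt ?_
  exact ENNReal.sum_lt_top.2 fun i _ => (hA i).2

/-- A finite family of sets, extended to a sequence by empty sets. -/
def extendEmpty {n : ℕ} (A : Fin n → Set Plane) (k : ℕ) : Set Plane :=
  if h : k < n then A ⟨k, h⟩ else ∅

lemma extendEmpty_coe {n : ℕ} (A : Fin n → Set Plane) (i : Fin n) : extendEmpty A i = A i := by
  simp [extendEmpty]

lemma extendEmpty_of_le {n : ℕ} (A : Fin n → Set Plane) {k : ℕ} (h : n ≤ k) :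
    extendEmpty A k = ∅ := by
  simp [extendEmpty, h]

lemma iUnion_extendEmpty {n : ℕ} (A : Fin n → Set Plane) : ⋃ k, extendEmpty A k = ⋃ i, A i := by
  ext s
  simp only [mem_iUnion]
  constructor
  · rintro ⟨k, hk⟩
    by_cases h : k < n
    · exact ⟨⟨k, h⟩, by simpa [extendEmpty, h] using hk⟩
    · simp [extendEmpty, h] at hk
  · rintro ⟨i, hi⟩
    exact ⟨i, by rwa [extendEmpty_coe]⟩

lemma measurableSet_extendEmpty {n : ℕ} {A : Fin n → Set Plane} (hA : ∀ i, IsFinBorel (A i))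
    (k : ℕ) : MeasurableSet (extendEmpty A k) := by
  by_cases h : k < n
  · simpa [extendEmpty, h] using (hA _).1
  · simp [extendEmpty, h]

lemma pairwise_disjoint_extendEmpty {n : ℕ} {A : Fin n → Set Plane}
    (hd : Pairwise (Function.onFun Disjoint A)) :
    Pairwise (Function.onFun Disjoint (extendEmpty A)) := by
  intro k l hkl
  by_cases h : k < n <;> by_cases h' : l < n <;> simp only [Function.onFun, extendEmpty, h, h',
    dite_true, dite_false, disjoint_empty, empty_disjoint]
  exact hd (by simpa using hkl)

lemma IsWhiteNoise.indep_fin (hW : IsWhiteNoise P W) {n : ℕ} {A : Fin n → Set Plane}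
    (hA : ∀ i, IsFinBorel (A i)) (hd : Pairwise (Function.onFun Disjoint A)) :
    iIndepFun (fun i => W (A i)) P := by
  have h := hW.indep (extendEmpty A) (measurableSet_extendEmpty hA)
    (pairwise_disjoint_extendEmpty hd) (by
      rw [iUnion_extendEmpty]; exact (isFinBorel_iUnion hA).2)
  have h2 := h.precomp (g := fun i : Fin n => (i : ℕ)) Fin.val_injective
  simpa only [extendEmpty_coe] using h2

lemma IsWhiteNoise.additive_fin (hW : IsWhiteNoise P W) {n : ℕ} {A : Fin n → Set Plane}
    (hA : ∀ i, IsFinBorel (A i)) (hd : Pairwise (Function.onFun Disjoint A)) :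
    ∀ᵐ ω ∂P, W (⋃ i, A i) ω = ∑ i, W (A i) ω := by
  have h := hW.sigma_additive (extendEmpty A) (measurableSet_extendEmpty hA)
    (pairwise_disjoint_extendEmpty hd) (by
      rw [iUnion_extendEmpty]; exact (isFinBorel_iUnion hA).2)
  filter_upwards [h, hW.ae_empty] with ω h1 h2
  rw [iUnion_extendEmpty] at h1
  refine tendsto_nhds_unique h1 ?_
  refine tendsto_const_nhds.congr' ?_
  filter_upwards [eventually_ge_atTop n] with N hN
  have : ∑ i, W (A i) ω = ∑ k ∈ Finset.range n, W (extendEmpty A k) ω := by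
    rw [← Fin.sum_univ_eq_sum_range (fun k => W (extendEmpty A k) ω) n]
    simp only [extendEmpty_coe]
  rw [this]
  refine Finset.sum_subset (by simpa using hN) fun k _ hk => ?_
  rw [extendEmpty_of_le A (by simpa using hk), h2]

lemma IsWhiteNoise.indep_fintype (hW : IsWhiteNoise P W) {ι : Type*} [Fintype ι]
    {A : ι → Set Plane} (hA : ∀ i, IsFinBorel (A i)) (hd : Pairwise (Function.onFun Disjoint A)) :
    iIndepFun (fun i => W (A i)) P := by
  have h := hW.indep_fin (A := A ∘ (Fintype.equivFin ι).symm) (fun i => hA _)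
    (hd.comp_of_injective (Fintype.equivFin ι).symm.injective)
  have h2 := h.precomp (g := Fintype.equivFin ι) (Fintype.equivFin ι).injective
  simpa using h2

lemma IsWhiteNoise.additive_fintype (hW : IsWhiteNoise P W) {ι : Type*} [Fintype ι]
    {A : ι → Set Plane} (hA : ∀ i, IsFinBorel (A i)) (hd : Pairwise (Function.onFun Disjoint A)) :
    ∀ᵐ ω ∂P, W (⋃ i, A i) ω = ∑ i, W (A i) ω := by
  have h := hW.additive_fin (A := A ∘ (Fintype.equivFin ι).symm) (fun i => hA _)
    (hd.comp_of_injective (Fintype.equivFin ι).symm.injective)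
  filter_upwards [h] with ω h
  rw [← (Fintype.equivFin ι).symm.sum_comp]
  rw [← (Fintype.equivFin ι).symm.surjective.iUnion_comp]
  exact h

/-- The part of the plane which is covered exactly by the sets `A i`, `i ∈ J`. -/
def atom {n : ℕ} (A : Fin n → Set Plane) (J : Finset (Fin n)) : Set Plane :=
  {s | (∀ i, s ∈ A i ↔ i ∈ J) ∧ J.Nonempty}

lemma pairwise_disjoint_atom {n : ℕ} (A : Fin n → Set Plane) :
    Pairwise (Function.onFun Disjoint (atom A)) := by
  intro J K hJK
  refine Set.disjoint_left.2 fun s hs ht => hJK ?_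
  ext i
  rw [← hs.1 i, ht.1 i]

/-- This is why `atom` demands `J.Nonempty`: otherwise the atom of `∅` would be the complement of
the union, of infinite measure. -/
lemma isFinBorel_atom {n : ℕ} {A : Fin n → Set Plane} (hA : ∀ i, IsFinBorel (A i))
    (J : Finset (Fin n)) : IsFinBorel (atom A J) := by
  rcases J.eq_empty_or_nonempty with rfl | ⟨j, hj⟩
  · convert isFinBorel_empty
    ext s; simp [atom]
  · refine ⟨?_, (measure_mono (fun s hs => (hs.1 j).2 hj)).trans_lt (hA j).2⟩
    have : atom A J = ⋂ i, {s | s ∈ A i ↔ i ∈ J} := by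
      ext s; simp [atom, show J.Nonempty from ⟨j, hj⟩]
    rw [this]
    refine MeasurableSet.iInter fun i => ?_
    by_cases h : i ∈ J
    · simpa [h] using (hA i).1
    · convert (hA i).1.compl using 1
      ext s; simp [h]

open Classical in
lemma iUnion_atom {n : ℕ} (A : Fin n → Set Plane) (i : Fin n) :
    (⋃ J : Finset (Fin n), if i ∈ J then atom A J else ∅) = A i := by
  ext s
  simp only [mem_iUnion]
  constructor
  · rintro ⟨J, hJ⟩
    split_ifs at hJ with h
    · exact (hJ.1 i).2 h
    · exact absurd hJ (by simp)
  · intro hs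
    refine ⟨Finset.univ.filter fun j => s ∈ A j, ?_⟩
    rw [if_pos (by simpa using hs)]
    exact ⟨by simp, i, by simpa using hs⟩

-- A point covered by some `A i` lies in exactly one atom, that of the set `J₀` of all indices whose
-- set contains it; at an uncovered point both sides vanish.
open Classical in
lemma sum_indicator_eq_atom {n : ℕ} (A : Fin n → Set Plane) (c : Fin n → ℝ) (s : Plane) :
    ∑ i, (A i).indicator (fun _ => c i) s
      = ∑ J : Finset (Fin n), (atom A J).indicator (fun _ => ∑ i ∈ J, c i) s := by
  set J₀ : Finset (Fin n) := Finset.univ.filter fun j => s ∈ A j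
  have h1 : ∑ i, (A i).indicator (fun _ => c i) s = ∑ i ∈ J₀, c i := by
    rw [Finset.sum_filter]
    rfl
  rw [h1, Finset.sum_eq_single J₀]
  · by_cases hn : J₀.Nonempty
    · rw [indicator_of_mem]
      exact ⟨by simp [J₀], hn⟩
    · rw [Finset.not_nonempty_iff_eq_empty.1 hn]
      simp [indicator]
  · intro J _ hJ
    rw [indicator_of_notMem]
    intro hs
    apply hJ
    ext i
    simp [J₀, hs.1 i]
  · simp

/-- The squared `L²` norm of `∑ i, c i * 1_{A i}`. -/
noncomputable def simpleVar {n : ℕ} (A : Fin n → Set Plane) (c : Fin n → ℝ) : ℝ :=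
  ∑ J : Finset (Fin n), (∑ i ∈ J, c i) ^ 2 * (volume (atom A J)).toReal

lemma simpleVar_nonneg {n : ℕ} (A : Fin n → Set Plane) (c : Fin n → ℝ) : 0 ≤ simpleVar A c :=
  Finset.sum_nonneg fun _ _ => by positivity

lemma continuous_simpleVar {n : ℕ} (A : Fin n → Set Plane) : Continuous (simpleVar A) := by
  unfold simpleVar; fun_prop

lemma lintegral_sum_indicator_sq {n : ℕ} {A : Fin n → Set Plane} (hA : ∀ i, IsFinBorel (A i))
    (c : Fin n → ℝ) :
    ∫⁻ s, ‖∑ i, (A i).indicator (fun _ => c i) s‖ₑ ^ 2 = ENNReal.ofReal (simpleVar A c) := by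
  have h1 : ∀ s, ‖∑ i, (A i).indicator (fun _ => c i) s‖ₑ ^ 2
      = ∑ J : Finset (Fin n),
        (atom A J).indicator (fun _ => ENNReal.ofReal ((∑ i ∈ J, c i) ^ 2)) s := by
    intro s
    rw [sum_indicator_eq_atom]
    by_cases hs : ∃ J, s ∈ atom A J
    · obtain ⟨J, hJ⟩ := hs
      have hne : ∀ K, K ≠ J → s ∉ atom A K := fun K hK h =>
        Set.disjoint_left.1 (pairwise_disjoint_atom A hK) h hJ
      rw [Finset.sum_eq_single J, Finset.sum_eq_single J, indicator_of_mem hJ, indicator_of_mem hJ]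
      · rw [← sq_abs, ENNReal.ofReal_pow (abs_nonneg _), Real.enorm_eq_ofReal_abs]
      all_goals simp +contextual [hne]
    · push Not at hs
      rw [Finset.sum_eq_zero, Finset.sum_eq_zero]
      · simp
      all_goals intro J _; exact indicator_of_notMem (hs J) _
  simp_rw [h1]
  rw [lintegral_finsetSum _ fun J _ => measurable_const.indicator (isFinBorel_atom hA J).1]
  unfold simpleVar
  rw [ENNReal.ofReal_sum_of_nonneg fun _ _ => by positivity]
  refine Finset.sum_congr rfl fun J _ => ?_
  rw [lintegral_indicator_const (isFinBorel_atom hA J).1, ENNReal.ofReal_mul (by positivity),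
    ENNReal.ofReal_toReal (isFinBorel_atom hA J).2.ne]

/-- Each `A i` is the disjoint union of the atoms with `i ∈ J`. Padding the other indices by `∅`,
where the noise vanishes almost surely, lets one index type serve all `i`. -/
lemma IsWhiteNoise.ae_eq_sum_atom (hW : IsWhiteNoise P W) {n : ℕ} {A : Fin n → Set Plane}
    (hA : ∀ i, IsFinBorel (A i)) (c : Fin n → ℝ) :
    ∀ᵐ ω ∂P, ∑ i, c i * W (A i) ω
      = ∑ J : Finset (Fin n), (∑ i ∈ J, c i) * W (atom A J) ω := by
  classical
  have h : ∀ i, ∀ᵐ ω ∂P, W (A i) ω = ∑ J : Finset (Fin n), if i ∈ J then W (atom A J) ω else 0 := by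
    intro i
    have := hW.additive_fintype (A := fun J : Finset (Fin n) => if i ∈ J then atom A J else ∅)
      (fun J => by split_ifs; exacts [isFinBorel_atom hA J, isFinBorel_empty])
      (fun J K hJK => by
        have := pairwise_disjoint_atom A hJK
        simp only [Function.onFun] at this ⊢
        split_ifs <;> simp [this])
    rw [iUnion_atom] at this
    filter_upwards [this, hW.ae_empty] with ω h1 h2
    rw [h1]
    refine Finset.sum_congr rfl fun J _ => ?_
    split_ifs
    · rfl
    · exact h2
  filter_upwards [ae_all_iff.2 h] with ω hω
  simp_rw [hω, Finset.mul_sum]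
  rw [Finset.sum_comm]
  refine Finset.sum_congr rfl fun J _ => ?_
  rw [Finset.sum_mul]
  simp

/-- Regrouped over atoms, the sum has independent Gaussian terms, so its law is Gaussian and the
variances add up to `simpleVar`. -/
lemma IsWhiteNoise.map_sum [IsProbabilityMeasure P] (hW : IsWhiteNoise P W) {n : ℕ}
    {A : Fin n → Set Plane} (hA : ∀ i, IsFinBorel (A i)) (c : Fin n → ℝ) :
    P.map (fun ω => ∑ i, c i * W (A i) ω) = gaussianReal 0 (simpleVar A c).toNNReal := by
  rw [Measure.map_congr (hW.ae_eq_sum_atom hA c)]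
  have hlaw : ∀ J, HasLaw (W (atom A J)) (gaussianReal 0 (volume (atom A J)).toNNReal) P :=
    fun J => ⟨(hW.measurable _ (isFinBorel_atom hA J)).aemeasurable,
      hW.law _ (isFinBorel_atom hA J)⟩
  have hlaw2 : ∀ J : Finset (Fin n), HasLaw (fun ω => (∑ i ∈ J, c i) * W (atom A J) ω)
      (gaussianReal ((∑ i ∈ J, c i) * 0)
        (.mk ((∑ i ∈ J, c i) ^ 2) (sq_nonneg _) * (volume (atom A J)).toNNReal)) P :=
    fun J => gaussianReal_const_mul (hlaw J) _
  have hind : iIndepFun (fun (J : Finset (Fin n)) ω => (∑ i ∈ J, c i) * W (atom A J) ω) P :=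
    (hW.indep_fintype (isFinBorel_atom hA) (pairwise_disjoint_atom A)).comp
      (fun J x => (∑ i ∈ J, c i) * x) (fun J => by fun_prop)
  have hG : ∀ J : Finset (Fin n), HasGaussianLaw (fun ω => (∑ i ∈ J, c i) * W (atom A J) ω) P :=
    fun J => (hlaw2 J).hasGaussianLaw
  rw [(hind.hasGaussianLaw_fun_sum hG).map_eq_gaussianReal]
  congr 1
  · rw [integral_finsetSum _ fun J _ => (hG J).integrable]
    refine Finset.sum_eq_zero fun J _ => ?_
    rw [(hlaw2 J).integral_eq]
    simp
  · congr 1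
    rw [← Finset.sum_fn, IndepFun.variance_sum (fun J _ => (hG J).memLp_two)
      fun J _ K _ hJK => hind.indepFun hJK]
    refine Finset.sum_congr rfl fun J _ => ?_
    rw [(hlaw2 J).variance_eq]
    simp
    left
    rfl

end Noise
-- Convergence in `L²` and moments of the Gaussian law.
-- The triangle inequality squeezes the seminorm of `f k` between `‖g‖ ∓ ‖f k - g‖`. With truncated
-- subtraction in `ℝ≥0∞` this needs no finiteness of the norms.
lemma tendsto_lintegral_sq {X : Type*} [MeasurableSpace X] {μ : Measure X} {f : ℕ → X → ℝ}
    {g : X → ℝ} (hf : ∀ k, AEStronglyMeasurable (f k) μ) (hg : AEStronglyMeasurable g μ)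
    (h : Tendsto (fun k => ∫⁻ x, ‖f k x - g x‖ₑ ^ 2 ∂μ) atTop (𝓝 0)) :
    Tendsto (fun k => ∫⁻ x, ‖f k x‖ₑ ^ 2 ∂μ) atTop (𝓝 (∫⁻ x, ‖g x‖ₑ ^ 2 ∂μ)) := by
  have key : ∀ u : X → ℝ, ∫⁻ x, ‖u x‖ₑ ^ 2 ∂μ = eLpNorm u 2 μ ^ 2 := by
    intro u
    have := eLpNorm_nnreal_pow_eq_lintegral (μ := μ) (f := u) (p := 2) (by norm_num)
    simp only [NNReal.coe_ofNat, ENNReal.coe_ofNat] at this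
    exact_mod_cast this.symm
  have key' : ∀ u : X → ℝ, eLpNorm u 2 μ = (∫⁻ x, ‖u x‖ₑ ^ 2 ∂μ) ^ (1 / 2 : ℝ) := by
    intro u
    rw [key, ← ENNReal.rpow_natCast, ← ENNReal.rpow_mul]
    norm_num
  have h' : Tendsto (fun k => eLpNorm (f k - g) 2 μ) atTop (𝓝 0) := by
    simp_rw [key']
    have := h.ennrpow_const (1 / 2 : ℝ)
    rwa [ENNReal.zero_rpow_of_pos (by norm_num)] at this
  have hlim : Tendsto (fun k => eLpNorm (f k) 2 μ) atTop (𝓝 (eLpNorm g 2 μ)) := by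
    have hlow : Tendsto (fun k => eLpNorm g 2 μ - eLpNorm (f k - g) 2 μ) atTop
        (𝓝 (eLpNorm g 2 μ)) := by
      have := ENNReal.Tendsto.sub (tendsto_const_nhds (x := eLpNorm g 2 μ)) h'
        (Or.inr ENNReal.zero_ne_top)
      simpa using this
    have hup : Tendsto (fun k => eLpNorm g 2 μ + eLpNorm (f k - g) 2 μ) atTop
        (𝓝 (eLpNorm g 2 μ)) := by
      simpa using (tendsto_const_nhds (x := eLpNorm g 2 μ)).add h'
    refine tendsto_of_tendsto_of_tendsto_of_le_of_le hlow hup (fun k => ?_) fun k => ?_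
    · refine tsub_le_iff_right.2 ?_
      calc eLpNorm g 2 μ = eLpNorm (f k - (f k - g)) 2 μ := by simp
        _ ≤ _ := eLpNorm_sub_le (hf k) ((hf k).sub hg) (by norm_num)
    · calc eLpNorm (f k) 2 μ = eLpNorm (g + (f k - g)) 2 μ := by simp
        _ ≤ _ := eLpNorm_add_le hg ((hf k).sub hg) (by norm_num)
  simp_rw [key]
  exact ENNReal.Tendsto.pow hlim

lemma exists_subseq_ae_tendsto_zero {X : Type*} [MeasurableSpace X] {μ : Measure X}
    {b : ℕ → X → ℝ≥0∞} (hb : ∀ k, Measurable (b k))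
    (h : Tendsto (fun k => ∫⁻ x, b k x ∂μ) atTop (𝓝 0)) :
    ∃ φ : ℕ → ℕ, StrictMono φ ∧ ∀ᵐ x ∂μ, Tendsto (fun j => b (φ j) x) atTop (𝓝 0) := by
  -- Integrals below `2⁻ʲ` along the subsequence make the series of the functions integrable, hence
  -- almost everywhere convergent.
  obtain ⟨φ, hφ, hle⟩ := extraction_forall_of_eventually'
    (P := fun j k => ∫⁻ x, b k x ∂μ ≤ (2⁻¹ : ℝ≥0∞) ^ j) fun j =>
      eventually_atTop.1
        (h.eventually_le_const (u := (2⁻¹ : ℝ≥0∞) ^ j) (ENNReal.pow_pos (by simp) j))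
  refine ⟨φ, hφ, ?_⟩
  have hsum : ∫⁻ x, ∑' j, b (φ j) x ∂μ ≠ ∞ := by
    rw [lintegral_tsum fun j => (hb _).aemeasurable]
    refine ne_top_of_le_ne_top ?_ (ENNReal.tsum_le_tsum hle)
    rw [ENNReal.tsum_geometric]
    simp
  filter_upwards [ae_lt_top (Measurable.tsum fun j => hb _) hsum] with x hx
  exact ENNReal.tendsto_atTop_zero_of_tsum_ne_top hx.ne

/-- The moment of order `2 * m` of the standard Gaussian law. -/
noncomputable def gaussMoment (m : ℕ) : ℝ≥0∞ := ∫⁻ x, ‖x‖ₑ ^ (2 * m) ∂gaussianReal 0 1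

lemma gaussMoment_ne_top (m : ℕ) : gaussMoment m ≠ ∞ := by
  rcases Nat.eq_zero_or_pos m with rfl | hm
  · simp [gaussMoment]
  have h := memLp_id_gaussianReal (μ := 0) (v := 1) ((2 * m : ℕ) : ℝ≥0)
  have h2 := lintegral_rpow_enorm_lt_top_of_eLpNorm_lt_top (by simp; omega)
    (ENNReal.coe_ne_top)
    h.eLpNorm_lt_top
  simp only [ENNReal.coe_toReal, NNReal.coe_natCast, ENNReal.rpow_natCast, id] at h2
  exact h2.ne

lemma lintegral_pow_gaussianReal (m : ℕ) {v : ℝ} (hv : 0 ≤ v) :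
    ∫⁻ x, ‖x‖ₑ ^ (2 * m) ∂gaussianReal 0 v.toNNReal = gaussMoment m * ENNReal.ofReal v ^ m := by
  have h := gaussianReal_map_const_mul (μ := 0) (v := 1) (Real.sqrt v)
  have h2 : gaussianReal 0 v.toNNReal = (gaussianReal 0 1).map (Real.sqrt v * ·) := by
    rw [h]
    congr 1
    · simp
    · ext; simp [Real.sq_sqrt hv, hv]
  rw [h2, lintegral_map (by fun_prop) (by fun_prop), gaussMoment,
    ← lintegral_mul_const _ (by fun_prop)]
  refine lintegral_congr fun x => ?_
  rw [enorm_mul, mul_pow, mul_comm]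
  congr 1
  rw [Real.enorm_eq_ofReal_abs, abs_of_nonneg (Real.sqrt_nonneg v), pow_mul,
    ← ENNReal.ofReal_pow (Real.sqrt_nonneg v), Real.sq_sqrt hv]

lemma gaussMoment_one : gaussMoment 1 = 1 := by
  have h : Var[fun x ↦ x; gaussianReal 0 1] = 1 := by simp
  have h3 : MemLp (fun x : ℝ => x) 2 (gaussianReal 0 1) := memLp_id_gaussianReal 2
  rw [variance_eq_integral measurable_id'.aemeasurable] at h
  simp only [integral_id_gaussianReal, sub_zero] at h
  have h2 := ofReal_integral_eq_lintegral_ofReal h3.integrable_sq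
    (ae_of_all _ fun x => sq_nonneg x)
  rw [h] at h2
  rw [gaussMoment, ← ENNReal.ofReal_one, h2]
  refine lintegral_congr fun x => ?_
  rw [mul_one, ← sq_abs, ENNReal.ofReal_pow (abs_nonneg _), Real.enorm_eq_ofReal_abs]

/-! ### The stochastic integral: isometry and conditional moment bounds. -/

section Integral

variable {Ω : Type*} {𝒢 : MeasurableSpace Ω} [mΩ : MeasurableSpace Ω] {P : Measure Ω}
  {W : Set Plane → Ω → ℝ} {σ : Plane → Ω → ℝ}

lemma fieldSigma_le (hσ : ∀ s, Measurable (σ s)) : fieldSigma σ ≤ mΩ :=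
  (measurable_pi_lambda _ hσ).comap_le

/-- The squared `L²` norm, in the space variable, of a simple integrand. -/
noncomputable def SimpleIntegrand.var (S : SimpleIntegrand 𝒢 P) (ω : Ω) :
    ℝ≥0∞ := ENNReal.ofReal (simpleVar S.set fun i => S.coef i ω)

lemma SimpleIntegrand.lintegral_eval_sq (S : SimpleIntegrand 𝒢 P) (ω : Ω) :
    ∫⁻ s, ‖S.eval s ω‖ₑ ^ 2 = S.var ω :=
  lintegral_sum_indicator_sq S.finBorel _

lemma SimpleIntegrand.measurable_coef (h𝒢 : 𝒢 ≤ mΩ)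
    (S : SimpleIntegrand 𝒢 P) (i : Fin S.n) : Measurable (S.coef i) :=
  (S.measurable i).mono h𝒢 le_rfl

lemma SimpleIntegrand.measurable_var (h𝒢 : 𝒢 ≤ mΩ)
    (S : SimpleIntegrand 𝒢 P) : Measurable S.var :=
  ENNReal.measurable_ofReal.comp ((continuous_simpleVar _).measurable.comp
    (measurable_pi_lambda _ fun i => S.measurable_coef h𝒢 i))

lemma SimpleIntegrand.measurable_eval (h𝒢 : 𝒢 ≤ mΩ)
    (S : SimpleIntegrand 𝒢 P) : Measurable (Function.uncurry S.eval) := by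
  have heq : Function.uncurry S.eval = fun p : Plane × Ω =>
      ∑ i, (S.set i).indicator (fun _ => S.coef i p.2) p.1 := rfl
  rw [heq]
  refine Finset.measurable_fun_sum _ fun i _ => ?_
  have : (fun p : Plane × Ω => (S.set i).indicator (fun _ => S.coef i p.2) p.1)
      = (S.set i ×ˢ univ).indicator fun p => S.coef i p.2 := by
    ext p
    by_cases h : p.1 ∈ S.set i <;> simp [indicator, h]
  rw [this]
  exact ((S.measurable_coef h𝒢 i).comp measurable_snd).indicator
    ((S.finBorel i).1.prod MeasurableSet.univ)

lemma SimpleIntegrand.measurable_integral (h𝒢 : 𝒢 ≤ mΩ)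
    (hW : IsWhiteNoise P W) (S : SimpleIntegrand 𝒢 P) : Measurable (S.integral W) :=
  Finset.measurable_fun_sum _ fun i _ =>
    (S.measurable_coef h𝒢 i).mul (hW.measurable _ (S.finBorel i))

/-- Coefficients and noise values are independent, so their joint law is a product; with the
coefficients frozen the integral is centred Gaussian with variance `S.var`. The free weight `θ`
plays the part of conditioning: `m = 1`, `θ = 1` gives the isometry, `θ = (v + ·)^(-m)` the higher
moment bounds. -/
lemma SimpleIntegrand.lintegral_integral_pow_mul [IsProbabilityMeasure P]
    (hσ : ∀ s, Measurable (σ s)) (hW : IsWhiteNoise P W) (hind : IndepVolNoise P σ W)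
    (S : SimpleIntegrand (fieldSigma σ) P) (m : ℕ) {θ : ℝ≥0∞ → ℝ≥0∞} (hθ : Measurable θ) :
    ∫⁻ ω, ‖S.integral W ω‖ₑ ^ (2 * m) * θ (S.var ω) ∂P
      = gaussMoment m * ∫⁻ ω, S.var ω ^ m * θ (S.var ω) ∂P := by
  have h𝒢 := fieldSigma_le hσ
  set c : Ω → Fin S.n → ℝ := fun ω i => S.coef i ω with hc
  set w : Ω → Fin S.n → ℝ := fun ω i => W (S.set i) ω with hw
  have hcm' : Measurable[fieldSigma σ] c :=
    @measurable_pi_lambda _ _ _ (fieldSigma σ) _ _ fun i => S.measurable i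
  have hcm : Measurable c := hcm'.mono h𝒢 le_rfl
  have hwm : Measurable w := measurable_pi_lambda _ fun i => hW.measurable _ (S.finBorel i)
  -- The coefficients are functions of the whole field `σ` and the noise values are finitely many
  -- coordinates of `W`, so independence of the two families is inherited.
  have hcw : IndepFun c w P := by
    have h1 : IndepFun (fun ω (s : Plane) => σ s ω) w P := by
      refine hind.comp (φ := id) (ψ := fun (x : {A : Set Plane // IsFinBorel A} → ℝ) i =>
        x ⟨S.set i, S.finBorel i⟩) measurable_id ?_
      exact measurable_pi_lambda _ fun i => measurable_pi_apply _
    rw [IndepFun_iff_Indep] at h1 ⊢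
    exact indep_of_indep_of_le_left h1 hcm'.comap_le
  have hprod := (indepFun_iff_map_prod_eq_prod_map_map hcm.aemeasurable hwm.aemeasurable).1 hcw
  have hvm : Measurable fun x : Fin S.n → ℝ => ENNReal.ofReal (simpleVar S.set x) :=
    ENNReal.measurable_ofReal.comp (continuous_simpleVar _).measurable
  set F : (Fin S.n → ℝ) × (Fin S.n → ℝ) → ℝ≥0∞ := fun p =>
    ‖∑ i, p.1 i * p.2 i‖ₑ ^ (2 * m) * θ (ENNReal.ofReal (simpleVar S.set p.1)) with hF
  have hFm : Measurable F := by
    refine Measurable.mul ?_ (hθ.comp (hvm.comp measurable_fst))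
    exact (Continuous.measurable (by fun_prop) : Measurable
      fun p : (Fin S.n → ℝ) × (Fin S.n → ℝ) => ∑ i, p.1 i * p.2 i).enorm.pow_const _
  calc ∫⁻ ω, ‖S.integral W ω‖ₑ ^ (2 * m) * θ (S.var ω) ∂P
      = ∫⁻ p, F p ∂(P.map fun ω => (c ω, w ω)) := by
        rw [lintegral_map hFm (hcm.prodMk hwm)]; rfl
    _ = ∫⁻ x, ∫⁻ y, F (x, y) ∂(P.map w) ∂(P.map c) := by
        rw [hprod, lintegral_prod _ hFm.aemeasurable]
    _ = ∫⁻ x, gaussMoment m * (ENNReal.ofReal (simpleVar S.set x) ^ m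
          * θ (ENNReal.ofReal (simpleVar S.set x))) ∂(P.map c) := by
        refine lintegral_congr fun x => ?_
        rw [lintegral_map (f := fun y => F (x, y)) (hFm.comp measurable_prodMk_left) hwm]
        simp only [hF]
        have hxm : Measurable fun ω => ∑ i, x i * w ω i :=
          Finset.measurable_fun_sum _ fun i _ =>
            measurable_const.mul (hW.measurable _ (S.finBorel i))
        rw [lintegral_mul_const _ (hxm.enorm.pow_const _), ← mul_assoc,
          ← lintegral_pow_gaussianReal m (simpleVar_nonneg S.set x), ← hW.map_sum S.finBorel x,
          lintegral_map (by fun_prop) hxm]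
    _ = _ := by
        have hvθ : Measurable fun x : Fin S.n → ℝ => gaussMoment m *
            (ENNReal.ofReal (simpleVar S.set x) ^ m * θ (ENNReal.ofReal (simpleVar S.set x))) :=
          ((hvm.pow_const m).mul (hθ.comp hvm)).const_mul _
        rw [lintegral_map hvθ hcm, ← lintegral_const_mul]
        · rfl
        · exact ((S.measurable_var h𝒢).pow_const m).mul (hθ.comp (S.measurable_var h𝒢))

/-- The difference of two simple integrands. -/
def SimpleIntegrand.sub (S T : SimpleIntegrand 𝒢 P) :
    SimpleIntegrand 𝒢 P where
  n := S.n + T.n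
  set := Fin.append S.set T.set
  coef := Fin.append S.coef fun i ω => -T.coef i ω
  finBorel := by
    refine Fin.addCases (fun i => ?_) fun i => ?_
    · simpa using S.finBorel i
    · simpa using T.finBorel i
  measurable := by
    refine Fin.addCases (fun i => ?_) fun i => ?_
    · simpa using S.measurable i
    · simp only [Fin.append_right]
      exact @Measurable.neg _ _ _ _ _ 𝒢 _ (T.measurable i)
  memLp := by
    refine Fin.addCases (fun i => ?_) fun i => ?_
    · simpa using S.memLp i
    · simp only [Fin.append_right]
      exact (T.memLp i).neg

lemma SimpleIntegrand.eval_sub (S T : SimpleIntegrand 𝒢 P) (s : Plane)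
    (ω : Ω) : (S.sub T).eval s ω = S.eval s ω - T.eval s ω := by
  simp only [eval]
  change ∑ i : Fin (S.n + T.n), ((Fin.append S.set T.set) i).indicator
    (fun _ => (Fin.append S.coef fun i ω => -T.coef i ω) i ω) s = _
  rw [Fin.sum_univ_add]
  simp only [Fin.append_left, Fin.append_right, sub_eq_add_neg, ← Finset.sum_neg_distrib]
  congr 1
  refine Finset.sum_congr rfl fun i _ => ?_
  by_cases h : s ∈ T.set i <;> simp [h]

lemma SimpleIntegrand.integral_sub (S T : SimpleIntegrand 𝒢 P) (ω : Ω) :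
    (S.sub T).integral W ω = S.integral W ω - T.integral W ω := by
  simp only [integral]
  change ∑ i : Fin (S.n + T.n), (Fin.append S.coef fun i ω => -T.coef i ω) i ω
    * W ((Fin.append S.set T.set) i) ω = _
  rw [Fin.sum_univ_add]
  simp [sub_eq_add_neg]

lemma enorm_sub_sub_sq_le (a b c d : ℝ) :
    ‖(a - b) - (c - d)‖ₑ ^ 2 ≤ 2 * ‖a - c‖ₑ ^ 2 + 2 * ‖b - d‖ₑ ^ 2 := by
  simp only [Real.enorm_eq_ofReal_abs]
  rw [← ENNReal.ofReal_pow (abs_nonneg _), ← ENNReal.ofReal_pow (abs_nonneg _),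
    ← ENNReal.ofReal_pow (abs_nonneg _), sq_abs, sq_abs, sq_abs,
    show (2 : ℝ≥0∞) = ENNReal.ofReal 2 by simp, ← ENNReal.ofReal_mul (by norm_num),
    ← ENNReal.ofReal_mul (by norm_num), ← ENNReal.ofReal_add (by positivity) (by positivity)]
  refine ENNReal.ofReal_le_ofReal ?_
  nlinarith [sq_nonneg ((a - c) + (b - d))]

lemma tendsto_lintegral_sub_sub {X : Type*} [MeasurableSpace X] {μ : Measure X} {f g : ℕ → X → ℝ}
    {f' g' : X → ℝ} (hf : ∀ k, Measurable (f k)) (hf' : Measurable f')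
    (hg : ∀ k, Measurable (g k)) (hg' : Measurable g')
    (h : Tendsto (fun k => ∫⁻ x, ‖f k x - f' x‖ₑ ^ 2 ∂μ) atTop (𝓝 0))
    (h' : Tendsto (fun k => ∫⁻ x, ‖g k x - g' x‖ₑ ^ 2 ∂μ) atTop (𝓝 0)) :
    Tendsto (fun k => ∫⁻ x, ‖(f k x - g k x) - (f' x - g' x)‖ₑ ^ 2 ∂μ) atTop (𝓝 0) := by
  have hlim : Tendsto (fun k => 2 * ∫⁻ x, ‖f k x - f' x‖ₑ ^ 2 ∂μ
      + 2 * ∫⁻ x, ‖g k x - g' x‖ₑ ^ 2 ∂μ) atTop (𝓝 0) := by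
    have := (ENNReal.Tendsto.const_mul (a := 2) h (Or.inr ENNReal.ofNat_ne_top)).add
      (ENNReal.Tendsto.const_mul (a := 2) h' (Or.inr ENNReal.ofNat_ne_top))
    simpa using this
  refine tendsto_of_tendsto_of_tendsto_of_le_of_le tendsto_const_nhds hlim
    (fun k => zero_le) fun k => ?_
  have hm1 : Measurable fun x => ‖f k x - f' x‖ₑ ^ 2 := ((hf k).sub hf').enorm.pow_const 2
  have hm2 : Measurable fun x => ‖g k x - g' x‖ₑ ^ 2 := ((hg k).sub hg').enorm.pow_const 2
  dsimp only
  rw [← lintegral_const_mul _ hm1, ← lintegral_const_mul _ hm2,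
    ← lintegral_add_left (hm1.const_mul _)]
  exact lintegral_mono fun x => enorm_sub_sub_sq_le _ _ _ _

/-- Turns the iterated integral of `IsStochasticIntegral` into an `L²` norm over one measure, to
which the general convergence lemmas apply. -/
lemma lintegral_lintegral_eq_prod [SFinite P] {H : Plane → Ω → ℝ}
    (hH : Measurable (Function.uncurry H)) :
    ∫⁻ ω, ∫⁻ s, ‖H s ω‖ₑ ^ 2 ∂volume ∂P
      = ∫⁻ p, ‖H p.1 p.2‖ₑ ^ 2 ∂((volume : Measure Plane).prod P) := by
  exact (lintegral_prod_symm' (μ := (volume : Measure Plane)) (ν := P)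
    (fun p => ‖H p.1 p.2‖ₑ ^ 2) (hH.enorm.pow_const 2)).symm

variable {H H' : Plane → Ω → ℝ} {Y Y' : Ω → ℝ}

lemma IsStochasticIntegral.sub [IsProbabilityMeasure P] (hσ : ∀ s, Measurable (σ s))
    (hW : IsWhiteNoise P W)
    (hH : Measurable (Function.uncurry H)) (hH' : Measurable (Function.uncurry H'))
    (h : IsStochasticIntegral (fieldSigma σ) P W H Y)
    (h' : IsStochasticIntegral (fieldSigma σ) P W H' Y') :
    IsStochasticIntegral (fieldSigma σ) P W (fun s ω => H s ω - H' s ω) (fun ω => Y ω - Y' ω) := by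
  have h𝒢 := fieldSigma_le hσ
  obtain ⟨hY, S, hS1, hS2⟩ := h
  obtain ⟨hY', S', hS1', hS2'⟩ := h'
  refine ⟨hY.sub hY', fun k => (S k).sub (S' k), ?_, ?_⟩
  · simp only [SimpleIntegrand.eval_sub]
    have e1 := fun k => lintegral_lintegral_eq_prod (P := P)
      (H := fun s ω => (S k).eval s ω - H s ω) (((S k).measurable_eval h𝒢).sub hH)
    have e2 := fun k => lintegral_lintegral_eq_prod (P := P)
      (H := fun s ω => (S' k).eval s ω - H' s ω) (((S' k).measurable_eval h𝒢).sub hH')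
    have e3 := fun k => lintegral_lintegral_eq_prod (P := P)
      (H := fun s ω => ((S k).eval s ω - (S' k).eval s ω) - (H s ω - H' s ω))
      ((((S k).measurable_eval h𝒢).sub ((S' k).measurable_eval h𝒢)).sub (hH.sub hH'))
    simp only [e1] at hS1
    simp only [e2] at hS1'
    simp only [e3]
    exact tendsto_lintegral_sub_sub (fun k => (S k).measurable_eval h𝒢) hH
      (fun k => (S' k).measurable_eval h𝒢) hH' hS1 hS1'
  · simp only [SimpleIntegrand.integral_sub]
    exact tendsto_lintegral_sub_sub (fun k => (S k).measurable_integral h𝒢 hW) hY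
      (fun k => (S' k).measurable_integral h𝒢 hW) hY' hS2 hS2'

lemma IsStochasticIntegral.isometry [IsProbabilityMeasure P] (hσ : ∀ s, Measurable (σ s))
    (hW : IsWhiteNoise P W) (hind : IndepVolNoise P σ W)
    (hH : Measurable (Function.uncurry H))
    (h : IsStochasticIntegral (fieldSigma σ) P W H Y) :
    ∫⁻ ω, ‖Y ω‖ₑ ^ 2 ∂P = ∫⁻ ω, ∫⁻ s, ‖H s ω‖ₑ ^ 2 ∂volume ∂P := by
  have h𝒢 := fieldSigma_le hσ
  obtain ⟨hY, S, hS1, hS2⟩ := h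
  have l1 := tendsto_lintegral_sq
    (fun k => ((S k).measurable_integral h𝒢 hW).aestronglyMeasurable) hY.aestronglyMeasurable hS2
  have e1 := fun k => lintegral_lintegral_eq_prod (P := P)
      (H := fun s ω => (S k).eval s ω - H s ω) (((S k).measurable_eval h𝒢).sub hH)
  simp only [e1] at hS1
  have l2 := tendsto_lintegral_sq (μ := (volume : Measure Plane).prod P)
    (f := fun k p => (S k).eval p.1 p.2) (g := fun p => H p.1 p.2)
    (fun k => ((S k).measurable_eval h𝒢).aestronglyMeasurable) hH.aestronglyMeasurable hS1
  rw [lintegral_lintegral_eq_prod hH]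
  refine tendsto_nhds_unique l1 (l2.congr fun k => ?_)
  rw [← lintegral_lintegral_eq_prod ((S k).measurable_eval h𝒢)]
  simp only [SimpleIntegrand.lintegral_eval_sq]
  have := (S k).lintegral_integral_pow_mul hσ hW hind 1 (θ := fun _ => 1) measurable_const
  simpa [gaussMoment_one] using this.symm

/-- `Y` is at finite `L²` distance from some elementary integral, and the latter is square
integrable by the isometry, since its coefficients are. -/
lemma IsStochasticIntegral.memLp [IsProbabilityMeasure P] (hσ : ∀ s, Measurable (σ s))
    (hW : IsWhiteNoise P W) (hind : IndepVolNoise P σ W)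
    (h : IsStochasticIntegral (fieldSigma σ) P W H Y) : MemLp Y 2 P := by
  have h𝒢 := fieldSigma_le hσ
  obtain ⟨hY, S, -, hS2⟩ := h
  obtain ⟨k, hk⟩ := (hS2.eventually_lt_const ENNReal.zero_lt_top).exists
  have hfin : ∀ {u : Ω → ℝ}, Measurable u → ∫⁻ ω, ‖u ω‖ₑ ^ 2 ∂P < ∞ → MemLp u 2 P := by
    intro u hu hlt
    refine ⟨hu.aestronglyMeasurable, ?_⟩
    rw [eLpNorm_lt_top_iff_lintegral_rpow_enorm_lt_top (by norm_num) (by norm_num)]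
    simpa using hlt
  have h1 : MemLp (fun ω => (S k).integral W ω - Y ω) 2 P :=
    hfin (((S k).measurable_integral h𝒢 hW).sub hY) hk
  have h2 : MemLp ((S k).integral W) 2 P := by
    refine hfin ((S k).measurable_integral h𝒢 hW) ?_
    have := (S k).lintegral_integral_pow_mul hσ hW hind 1 (θ := fun _ => 1) measurable_const
    simp only [mul_one, gaussMoment_one, one_mul, pow_one] at this
    rw [this]
    simp only [SimpleIntegrand.var, simpleVar]
    have hi : Integrable (fun ω => ∑ J : Finset (Fin (S k).n), (∑ i ∈ J, (S k).coef i ω) ^ 2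
        * (volume (atom (S k).set J)).toReal) P := by
      refine integrable_finsetSum _ fun J _ => Integrable.mul_const ?_ _
      exact (memLp_finsetSum J fun i _ => (S k).memLp i).integrable_sq
    exact hi.lintegral_lt_top
  have h3 := h2.sub h1
  convert h3 using 1
  ext ω; simp

/-- For a simple integrand the left side is the Gaussian moment times the mean of `(V / (v + V))^m ≤
1`, a bound uniform in the integrand. It survives the limit by Fatou, along a subsequence on which
the integrals and the conditional variances both converge almost surely. -/
lemma IsStochasticIntegral.lintegral_pow_div_le [IsProbabilityMeasure P]
    (hσ : ∀ s, Measurable (σ s))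
    (hW : IsWhiteNoise P W) (hind : IndepVolNoise P σ W) (hH : Measurable (Function.uncurry H))
    (h : IsStochasticIntegral (fieldSigma σ) P W H Y) (m : ℕ) {v : ℝ≥0∞} (hv : v ≠ 0) :
    ∫⁻ ω, ‖Y ω‖ₑ ^ (2 * m) * ((v + ∫⁻ s, ‖H s ω‖ₑ ^ 2) ^ m)⁻¹ ∂P ≤ gaussMoment m := by
  have h𝒢 := fieldSigma_le hσ
  obtain ⟨hY, S, hS1, hS2⟩ := h
  have hIm := fun k => (S k).measurable_integral h𝒢 hW
  have hm1 : ∀ k, Measurable fun ω => ∫⁻ s, ‖(S k).eval s ω - H s ω‖ₑ ^ 2 := fun k =>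
    Measurable.lintegral_prod_left' (f := fun p : Plane × Ω => ‖(S k).eval p.1 p.2 - H p.1 p.2‖ₑ ^ 2)
      ((((S k).measurable_eval h𝒢).sub hH).enorm.pow_const 2)
  have hm2 : ∀ k, Measurable fun ω => ‖(S k).integral W ω - Y ω‖ₑ ^ 2 := fun k =>
    ((hIm k).sub hY).enorm.pow_const 2
  -- The two error terms are added so that a single subsequence handles both.
  obtain ⟨φ, hφ, hlim⟩ := exists_subseq_ae_tendsto_zero (μ := P)
    (b := fun k ω => (∫⁻ s, ‖(S k).eval s ω - H s ω‖ₑ ^ 2) + ‖(S k).integral W ω - Y ω‖ₑ ^ 2)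
    (fun k => (hm1 k).add (hm2 k)) (by
      simp only [lintegral_add_left (hm1 _)]
      simpa using hS1.add hS2)
  set θ : ℝ≥0∞ → ℝ≥0∞ := fun x => ((v + x) ^ m)⁻¹ with hθ
  have hθm : Measurable θ := ((measurable_const.add measurable_id).pow_const m).inv
  have hθc : Continuous θ := by
    exact continuous_inv.comp ((ENNReal.continuous_pow m).comp (continuous_const.add continuous_id))
  have hbound : ∀ k, ∫⁻ ω, ‖(S k).integral W ω‖ₑ ^ (2 * m) * θ ((S k).var ω) ∂P
      ≤ gaussMoment m := by
    intro k
    rw [(S k).lintegral_integral_pow_mul hσ hW hind m hθm]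
    refine mul_le_of_le_one_right (zero_le) ?_
    calc ∫⁻ ω, (S k).var ω ^ m * θ ((S k).var ω) ∂P ≤ ∫⁻ ω, 1 ∂P := by
          refine lintegral_mono fun ω => ?_
          simp only [hθ, ← div_eq_mul_inv]
          exact ENNReal.div_le_of_le_mul (by
            rw [one_mul]; exact pow_le_pow_left' le_add_self m)
      _ = 1 := by simp
  calc ∫⁻ ω, ‖Y ω‖ₑ ^ (2 * m) * θ (∫⁻ s, ‖H s ω‖ₑ ^ 2) ∂P
      ≤ ∫⁻ ω, liminf (fun j => ‖(S (φ j)).integral W ω‖ₑ ^ (2 * m) * θ ((S (φ j)).var ω)) atTop ∂P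
        := by
        refine lintegral_mono_ae ?_
        filter_upwards [hlim] with ω hω
        refine le_of_eq (Tendsto.liminf_eq ?_).symm
        have t1 : Tendsto (fun j => ∫⁻ s, ‖(S (φ j)).eval s ω - H s ω‖ₑ ^ 2) atTop (𝓝 0) :=
          tendsto_of_tendsto_of_tendsto_of_le_of_le tendsto_const_nhds hω (fun _ => zero_le)
            fun j => le_self_add
        have t2 : Tendsto (fun j => ‖(S (φ j)).integral W ω - Y ω‖ₑ ^ 2) atTop (𝓝 0) :=
          tendsto_of_tendsto_of_tendsto_of_le_of_le tendsto_const_nhds hω (fun _ => zero_le)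
            fun j => le_add_self
        have t3 := tendsto_lintegral_sq
          (fun j => (((S (φ j)).measurable_eval h𝒢).comp
            measurable_prodMk_right).aestronglyMeasurable)
          ((hH.comp measurable_prodMk_right).aestronglyMeasurable (μ := volume)) t1
        simp only [Function.comp_def, Function.uncurry] at t3
        simp only [SimpleIntegrand.lintegral_eval_sq] at t3
        have t4 : Tendsto (fun j => (S (φ j)).integral W ω) atTop (𝓝 (Y ω)) := by
          rw [tendsto_iff_edist_tendsto_0]
          have := t2.ennrpow_const (1 / 2 : ℝ)
          rw [ENNReal.zero_rpow_of_pos (by norm_num)] at this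
          refine this.congr fun j => ?_
          rw [← ENNReal.rpow_natCast, ← ENNReal.rpow_mul, edist_eq_enorm_sub]
          norm_num
        -- The form `0 * ∞` is excluded: `θ` is finite because `v ≠ 0`, and `Y ω` is real.
        refine ENNReal.Tendsto.mul (ENNReal.Tendsto.pow t4.enorm) (Or.inr ?_)
          ((hθc.tendsto _).comp t3) (Or.inr ?_)
        · simp [hθ, hv]
        · exact ENNReal.pow_ne_top enorm_ne_top
    _ ≤ liminf (fun j => ∫⁻ ω, ‖(S (φ j)).integral W ω‖ₑ ^ (2 * m) * θ ((S (φ j)).var ω) ∂P) atTop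
        := lintegral_liminf_le fun j => ((hIm _).enorm.pow_const _).mul
            (hθm.comp ((S (φ j)).measurable_var h𝒢))
    _ ≤ gaussMoment m := by
        refine liminf_le_of_frequently_le' (Frequently.of_forall fun j => hbound _)

/-- Markov's inequality for the weighted moment: where the conditional variance is at most `v`, the
weight is at least `(2v)^(-m)`. -/
lemma IsStochasticIntegral.measure_le [IsProbabilityMeasure P] (hσ : ∀ s, Measurable (σ s))
    (hW : IsWhiteNoise P W) (hind : IndepVolNoise P σ W) (hH : Measurable (Function.uncurry H))
    (h : IsStochasticIntegral (fieldSigma σ) P W H Y) (m : ℕ) {v ρ : ℝ} (hv : 0 < v) (hρ : 0 < ρ) :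
    P {ω | ρ ≤ |Y ω| ∧ ∫⁻ s, ‖H s ω‖ₑ ^ 2 ≤ ENNReal.ofReal v}
      ≤ gaussMoment m * ENNReal.ofReal ((2 * v) ^ m / ρ ^ (2 * m)) := by
  have h1 := h.lintegral_pow_div_le hσ hW hind hH m (v := ENNReal.ofReal v) (by simpa using hv)
  have hVm : Measurable fun ω => ∫⁻ s, ‖H s ω‖ₑ ^ 2 :=
    Measurable.lintegral_prod_left' (f := fun p : Plane × Ω => ‖H p.1 p.2‖ₑ ^ 2)
      (hH.enorm.pow_const 2)
  have hm : Measurable fun ω => ‖Y ω‖ₑ ^ (2 * m) *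
      ((ENNReal.ofReal v + ∫⁻ s, ‖H s ω‖ₑ ^ 2) ^ m)⁻¹ :=
    (h.1.enorm.pow_const _).mul ((measurable_const.add hVm).pow_const m).inv
  set b := ENNReal.ofReal (ρ ^ (2 * m) / (2 * v) ^ m) with hb
  have hb0 : b ≠ 0 := by rw [hb]; simp; positivity
  have hsub : {ω | ρ ≤ |Y ω| ∧ ∫⁻ s, ‖H s ω‖ₑ ^ 2 ≤ ENNReal.ofReal v} ⊆
      {ω | b ≤ ‖Y ω‖ₑ ^ (2 * m) * ((ENNReal.ofReal v + ∫⁻ s, ‖H s ω‖ₑ ^ 2) ^ m)⁻¹} := by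
    rintro ω ⟨hY, hV⟩
    simp only [mem_ofPred_eq, hb]
    rw [div_eq_mul_inv, ENNReal.ofReal_mul (by positivity), ENNReal.ofReal_inv_of_pos (by positivity),
      ENNReal.ofReal_pow hρ.le, ENNReal.ofReal_pow (by positivity)]
    gcongr
    · rw [Real.enorm_eq_ofReal_abs]; exact ENNReal.ofReal_le_ofReal hY
    · rw [two_mul, ENNReal.ofReal_add hv.le hv.le]
      gcongr
  refine (measure_mono hsub).trans ?_
  refine (meas_ge_le_lintegral_div hm.aemeasurable hb0 ENNReal.ofReal_ne_top).trans ?_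
  refine (ENNReal.div_le_div_right h1 b).trans ?_
  rw [div_eq_mul_inv, hb, ← ENNReal.ofReal_inv_of_pos (by positivity), inv_div]

end Integral

/-! ### Power bounds for the kernel profile and its derivative. -/

section Profile

variable {α M : ℝ} {L : ℝ → ℝ}

lemma KernelAssumptions.hasDerivAt (hL : KernelAssumptions α L M) {x : ℝ} (hx : 0 < x) :
    HasDerivAt L (deriv L x) x :=
  ((hL.contDiffOn.contDiffAt (Ioi_mem_nhds hx)).differentiableAt one_ne_zero).hasDerivAt

lemma KernelAssumptions.hasDerivAt_profile (hL : KernelAssumptions α L M) {x : ℝ} (hx : 0 < x) :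
    HasDerivAt (profile α L) (α * x ^ (α - 1) * L x + x ^ α * deriv L x) x :=
  (Real.hasDerivAt_rpow_const (Or.inl hx.ne')).mul (hL.hasDerivAt hx)

lemma KernelAssumptions.contDiffOn_profile (hL : KernelAssumptions α L M) :
    ContDiffOn ℝ 1 (profile α L) (Ioi 0) :=
  ContDiffOn.mul (fun _ hx => (Real.contDiffAt_rpow_const_of_ne (ne_of_gt hx)).contDiffWithinAt)
    hL.contDiffOn

lemma KernelAssumptions.continuousOn_deriv_profile (hL : KernelAssumptions α L M) :
    ContinuousOn (deriv (profile α L)) (Ioi 0) :=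
  hL.contDiffOn_profile.continuousOn_deriv_of_isOpen isOpen_Ioi le_rfl

lemma KernelAssumptions.measurable_kernel (hL : KernelAssumptions α L M) :
    Measurable (kernel α L) := by
  refine measurable_of_continuousOn_compl_singleton 0 ?_
  refine hL.contDiffOn_profile.continuousOn.comp continuous_norm.continuousOn fun x hx => ?_
  exact norm_pos_iff.2 hx

/-- On `(0, 1]` one has `1 ≤ x⁻¹`, so `|L'(x)| ≤ 2C/x`; in the variable `u = log x` this says that
`L ∘ exp` is Lipschitz on `(-∞, 0]`. -/
lemma KernelAssumptions.abs_sub_le_log (hL : KernelAssumptions α L M) :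
    ∃ C : ℝ, 0 < C ∧ (∀ x ∈ Ioc (0 : ℝ) 1, |deriv L x| ≤ C * x⁻¹) ∧
      ∀ x ∈ Ioc (0 : ℝ) 1, ∀ y ∈ Ioc (0 : ℝ) 1, |L x - L y| ≤ C * |Real.log x - Real.log y| := by
  obtain ⟨C, hC, h⟩ := hL.deriv_bound
  have hd : ∀ x ∈ Ioc (0 : ℝ) 1, |deriv L x| ≤ 2 * C * x⁻¹ := by
    intro x hx
    refine (h x hx).le.trans ?_
    have : 1 ≤ x⁻¹ := (one_le_inv₀ hx.1).2 hx.2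
    nlinarith
  refine ⟨2 * C, by positivity, hd, fun x hx y hy => ?_⟩
  have hderiv : ∀ u ∈ Iic (0 : ℝ), HasDerivWithinAt (fun u => L (Real.exp u))
      (deriv L (Real.exp u) * Real.exp u) (Iic 0) u := fun u _ =>
    ((hL.hasDerivAt (Real.exp_pos u)).comp u (Real.hasDerivAt_exp u)).hasDerivWithinAt
  have hb : ∀ u ∈ Iic (0 : ℝ), ‖deriv L (Real.exp u) * Real.exp u‖ ≤ 2 * C := by
    intro u hu
    have h1 := hd (Real.exp u) ⟨Real.exp_pos u, Real.exp_le_one_iff.2 hu⟩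
    rw [norm_mul, Real.norm_eq_abs, Real.norm_eq_abs, abs_of_pos (Real.exp_pos u)]
    calc _ ≤ 2 * C * (Real.exp u)⁻¹ * Real.exp u := by gcongr
      _ = 2 * C := by rw [mul_assoc, inv_mul_cancel₀ (Real.exp_pos u).ne', mul_one]
  have := (convex_Iic (0 : ℝ)).norm_image_sub_le_of_norm_hasDerivWithin_le hderiv hb
    (x := Real.log y) (y := Real.log x) (Real.log_nonpos hy.1.le hy.2)
    (Real.log_nonpos hx.1.le hx.2)
  simpa [Real.exp_log hx.1, Real.exp_log hy.1] using this

lemma abs_log_le_rpow_neg {η x : ℝ} (hη : 0 < η) (hx : 0 < x) (hx1 : x ≤ 1) :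
    |Real.log x| ≤ η⁻¹ * x ^ (-η) := by
  have h := (Real.abs_log_mul_self_rpow_lt x η hx hx1 hη).le
  rw [abs_mul, abs_of_pos (Real.rpow_pos_of_pos hx η)] at h
  rw [Real.rpow_neg hx.le, ← div_eq_mul_inv, le_div_iff₀ (Real.rpow_pos_of_pos hx η)]
  simpa using h

/-- `L` grows at most logarithmically at `0`, and a logarithm costs an arbitrarily small power
`x^(-η)`. No lower bound on `L` enters, so this serves part (ii). -/
lemma KernelAssumptions.profile_bounds (hL : KernelAssumptions α L M) {η : ℝ} (hη : 0 < η) :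
    ∃ A : ℝ, 0 < A ∧ ∀ x ∈ Ioc (0 : ℝ) 1, |profile α L x| ≤ A * x ^ (α - η) ∧
      |deriv (profile α L) x| ≤ A * x ^ (α - η - 1) := by
  obtain ⟨C, hC, hd, hlog⟩ := hL.abs_sub_le_log
  have hL1 := hL.pos 1 one_pos
  set B := L 1 + C * η⁻¹ with hB
  have hB0 : 0 < B := by positivity
  have hLb : ∀ x ∈ Ioc (0 : ℝ) 1, L x ≤ B * x ^ (-η) := by
    intro x hx
    have h1 := hlog x hx 1 ⟨one_pos, le_rfl⟩
    rw [Real.log_one, sub_zero] at h1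
    have h2 := abs_log_le_rpow_neg hη hx.1 hx.2
    have h3 : 1 ≤ x ^ (-η) := Real.one_le_rpow_of_pos_of_le_one_of_nonpos hx.1 hx.2 (by linarith)
    have h4 := (abs_le.1 h1).2
    have h5 : C * |Real.log x| ≤ C * (η⁻¹ * x ^ (-η)) := by gcongr
    rw [hB]; nlinarith
  refine ⟨|α| * B + C + B, by positivity, fun x hx => ⟨?_, ?_⟩⟩
  · rw [profile, abs_mul, abs_of_pos (Real.rpow_pos_of_pos hx.1 α), abs_of_pos (hL.pos x hx.1),
      sub_eq_add_neg, Real.rpow_add hx.1]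
    have h1 := hLb x hx
    have h2 : 0 < x ^ α := Real.rpow_pos_of_pos hx.1 α
    have h3 : 0 < x ^ (-η) := Real.rpow_pos_of_pos hx.1 _
    calc x ^ α * L x ≤ x ^ α * (B * x ^ (-η)) := by gcongr
      _ = B * (x ^ α * x ^ (-η)) := by ring
      _ ≤ _ := by
        gcongr
        have : 0 ≤ |α| * B := by positivity
        linarith
  · rw [(hL.hasDerivAt_profile hx.1).deriv]
    have h2 : 0 < x ^ (α - 1) := Real.rpow_pos_of_pos hx.1 _
    have h3 : 1 ≤ x ^ (-η) := Real.one_le_rpow_of_pos_of_le_one_of_nonpos hx.1 hx.2 (by linarith)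
    have h1 := hLb x hx
    have hα : x ^ α = x ^ (α - 1) * x := by
      rw [← Real.rpow_add_one hx.1.ne']; ring_nf
    have h6 : |x ^ α * deriv L x| ≤ x ^ (α - 1) * C := by
      rw [abs_mul, abs_of_pos (Real.rpow_pos_of_pos hx.1 α), hα]
      calc x ^ (α - 1) * x * |deriv L x| ≤ x ^ (α - 1) * x * (C * x⁻¹) := by
            have := hd x hx
            have := hx.1
            gcongr
        _ = x ^ (α - 1) * C * (x * x⁻¹) := by ring
        _ = _ := by rw [mul_inv_cancel₀ hx.1.ne', mul_one]
    have h7 : |α * x ^ (α - 1) * L x| ≤ x ^ (α - 1) * (|α| * B * x ^ (-η)) := by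
      rw [abs_mul, abs_mul, abs_of_pos h2, abs_of_pos (hL.pos x hx.1)]
      calc |α| * x ^ (α - 1) * L x ≤ |α| * x ^ (α - 1) * (B * x ^ (-η)) := by gcongr
        _ = _ := by ring
    have e : x ^ (α - η - 1) = x ^ (α - 1) * x ^ (-η) := by
      rw [← Real.rpow_add hx.1]; ring_nf
    rw [e]
    calc _ ≤ x ^ (α - 1) * (|α| * B * x ^ (-η)) + x ^ (α - 1) * C :=
          (abs_add_le _ _).trans (add_le_add h7 h6)
      _ = x ^ (α - 1) * (|α| * B * x ^ (-η) + C) := by ring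
      _ ≤ x ^ (α - 1) * (|α| * B * x ^ (-η) + C * x ^ (-η) + B * x ^ (-η)) := by
          refine mul_le_mul_of_nonneg_left ?_ h2.le
          have : 0 ≤ B * x ^ (-η) := by positivity
          nlinarith
      _ = _ := by ring

/-- Under a lower bound on `L` near the origin, the ratios `L (h * y) / L h` and their derivatives
are bounded by powers of `y`, uniformly in `h`. -/
lemma KernelAssumptions.scaled_profile_bounds (hL : KernelAssumptions α L M) {c : ℝ} (hc : 0 < c)
    (hcL : ∀ x ∈ Ioc (0 : ℝ) 1, c ≤ L x) {η : ℝ} (hη : 0 < η) :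
    ∃ A : ℝ, 0 < A ∧ ∀ h ∈ Ioc (0 : ℝ) 1,
      (∀ y, 0 < y → y ≤ 2 → h * y ≤ 1 →
        |profile α L (h * y)| ≤ A * (h ^ α * L h) * y ^ (α - η)) ∧
      ∀ y, 1 ≤ y → h * y ≤ 1 →
        |h * deriv (profile α L) (h * y)| ≤ A * (h ^ α * L h) * y ^ (α + η - 1) := by
  obtain ⟨C, hC, hd, hlog⟩ := hL.abs_sub_le_log
  -- The logarithmic estimate between `hy` and `h` involves only `log y`; dividing by `L h ≥ c`
  -- makes it relative, uniformly in `h`.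
  have hratio : ∀ h ∈ Ioc (0 : ℝ) 1, ∀ y, 0 < y → h * y ≤ 1 →
      L (h * y) ≤ L h * (1 + C / c * |Real.log y|) := by
    intro h hh y hy hy1
    have h1 := hlog (h * y) ⟨mul_pos hh.1 hy, hy1⟩ h hh
    rw [Real.log_mul hh.1.ne' hy.ne', add_sub_cancel_left] at h1
    have h2 := (abs_le.1 h1).2
    have h3 := hcL h hh
    have h4 : C * |Real.log y| ≤ L h * (C / c * |Real.log y|) := by
      calc C * |Real.log y| = c * (C / c * |Real.log y|) := by field_simp
        _ ≤ _ := by gcongr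
    nlinarith
  set K := η⁻¹ + 2 ^ η with hK
  have h2η : (0 : ℝ) < 2 ^ η := Real.rpow_pos_of_pos two_pos η
  -- The range extends to `2` because `‖x ± e/2‖ ≤ 2` for `‖x‖ ≤ 3/2`, the inner region of the
  -- dominating function.
  have hone : ∀ y : ℝ, 0 < y → y ≤ 2 → 1 ≤ 2 ^ η * y ^ (-η) := by
    intro y hy hy2
    rw [Real.rpow_neg hy.le, ← div_eq_mul_inv, le_div_iff₀ (Real.rpow_pos_of_pos hy η), one_mul]
    exact Real.rpow_le_rpow hy.le hy2 hη.le
  have hlogsmall : ∀ y : ℝ, 0 < y → y ≤ 2 → |Real.log y| ≤ K * y ^ (-η) := by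
    intro y hy hy2
    have hyη := Real.rpow_pos_of_pos hy (-η)
    rcases le_total y 1 with h1 | h1
    · refine (abs_log_le_rpow_neg hη hy h1).trans ?_
      gcongr
      rw [hK]; linarith
    · have e1 : |Real.log y| ≤ 1 := by
        rw [abs_of_nonneg (Real.log_nonneg h1)]
        have := Real.log_le_sub_one_of_pos hy
        linarith
      refine e1.trans ((hone y hy hy2).trans ?_)
      gcongr
      rw [hK]
      have : 0 < η⁻¹ := by positivity
      linarith
  set A₁ := 2 ^ η + C / c * K with hA₁
  set A₂ := |α| * (1 + C / c * η⁻¹) + C / c with hA₂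
  have hA₁0 : 0 < A₁ := by positivity
  have hA₂0 : 0 ≤ A₂ := by positivity
  refine ⟨A₁ + A₂, by positivity, fun h hh => ?_⟩
  have hLh := hL.pos h hh.1
  have hhα := Real.rpow_pos_of_pos hh.1 α
  constructor
  · intro y hy hy2 hy1
    have hyα := Real.rpow_pos_of_pos hy α
    have hyη := Real.rpow_pos_of_pos hy (-η)
    have hhy := mul_pos hh.1 hy
    rw [profile, abs_mul, abs_of_pos (Real.rpow_pos_of_pos hhy α), abs_of_pos (hL.pos _ hhy),
      Real.mul_rpow hh.1.le hy.le, sub_eq_add_neg, Real.rpow_add hy]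
    calc h ^ α * y ^ α * L (h * y)
        ≤ h ^ α * y ^ α * (L h * (1 + C / c * |Real.log y|)) := by
          gcongr; exact hratio h hh y hy hy1
      _ ≤ h ^ α * y ^ α * (L h * (2 ^ η * y ^ (-η) + C / c * (K * y ^ (-η)))) := by
          gcongr
          · exact hone y hy hy2
          · exact hlogsmall y hy hy2
      _ = A₁ * (h ^ α * L h) * (y ^ α * y ^ (-η)) := by rw [hA₁]; ring
      _ ≤ _ := by gcongr; linarith
  · intro y hy hy1
    have hy0 : 0 < y := by linarith
    have hhy := mul_pos hh.1 hy0
    have hyα := Real.rpow_pos_of_pos hy0 (α - 1)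
    have hyη : 1 ≤ y ^ η := Real.one_le_rpow hy hη.le
    rw [(hL.hasDerivAt_profile hhy).deriv]
    have e1 : h * (h * y) ^ (α - 1) = h ^ α * y ^ (α - 1) := by
      rw [Real.mul_rpow hh.1.le hy0.le, ← mul_assoc]
      congr 1
      rw [mul_comm, ← Real.rpow_add_one hh.1.ne']; ring_nf
    have e2 : y ^ α = y ^ (α - 1) * y := by
      rw [← Real.rpow_add_one hy0.ne']; ring_nf
    have hl : Real.log y ≤ η⁻¹ * y ^ η := by
      have := Real.log_le_rpow_div hy0.le hη
      rwa [div_eq_inv_mul] at this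
    have b1 : |h * (α * (h * y) ^ (α - 1) * L (h * y))|
        ≤ |α| * (1 + C / c * η⁻¹) * (h ^ α * L h) * (y ^ (α - 1) * y ^ η) := by
      have : h * (α * (h * y) ^ (α - 1) * L (h * y))
          = α * (h ^ α * y ^ (α - 1)) * L (h * y) := by rw [← e1]; ring
      rw [this, abs_mul, abs_mul, abs_of_pos (mul_pos hhα hyα), abs_of_pos (hL.pos _ hhy)]
      calc |α| * (h ^ α * y ^ (α - 1)) * L (h * y)
          ≤ |α| * (h ^ α * y ^ (α - 1)) * (L h * (1 + C / c * |Real.log y|)) := by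
            gcongr; exact hratio h hh y hy0 hy1
        _ ≤ |α| * (h ^ α * y ^ (α - 1)) * (L h * (y ^ η + C / c * (η⁻¹ * y ^ η))) := by
            rw [abs_of_nonneg (Real.log_nonneg hy)]
            gcongr
        _ = _ := by ring
    have b2 : |h * ((h * y) ^ α * deriv L (h * y))|
        ≤ C / c * (h ^ α * L h) * (y ^ (α - 1) * y ^ η) := by
      rw [abs_mul, abs_mul, abs_of_pos hh.1, abs_of_pos (Real.rpow_pos_of_pos hhy α)]
      calc h * ((h * y) ^ α * |deriv L (h * y)|)
          ≤ h * ((h * y) ^ α * (C * (h * y)⁻¹)) := by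
            have := hd (h * y) ⟨hhy, hy1⟩
            have := hh.1
            gcongr
        _ = C * h ^ α * y ^ (α - 1) := by
            rw [Real.mul_rpow hh.1.le hy0.le, e2]
            have := hh.1.ne'
            field_simp
        _ = C / c * (h ^ α * c) * (y ^ (α - 1) * 1) := by field_simp
        _ ≤ _ := by
            gcongr
            exact hcL h hh
    have e3 : y ^ (α + η - 1) = y ^ (α - 1) * y ^ η := by
      rw [← Real.rpow_add hy0]; ring_nf
    rw [mul_add, e3]
    refine (abs_add_le _ _).trans ((add_le_add b1 b2).trans ?_)
    calc _ = A₂ * (h ^ α * L h) * (y ^ (α - 1) * y ^ η) := by rw [hA₂]; ring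
      _ ≤ _ := by gcongr; linarith

/-- A decreasing majorant of the derivative of the profile away from the origin which is square
integrable over the plane. -/
lemma KernelAssumptions.exists_antitone_majorant (hL : KernelAssumptions α L M) {u : ℝ}
    (hu : 0 < u) : ∃ ψ : ℝ → ℝ, Antitone ψ ∧ (∀ r, 0 ≤ ψ r) ∧
      (∀ r, u ≤ r → |deriv (profile α L) r| ≤ ψ r) ∧
      Integrable (fun y : Plane => ψ (‖y‖ - 1) ^ 2) volume := by
  set D := deriv (profile α L) with hD
  have hcont : ContinuousOn (fun r => |D r|) (Icc u (M + 1)) :=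
    (hL.continuousOn_deriv_profile.abs).mono fun r hr => lt_of_lt_of_le hu hr.1
  obtain ⟨K₀, hK₀⟩ := isCompact_Icc.bddAbove_image hcont
  set K := max K₀ |D M| with hK
  have hKnn : 0 ≤ K := (abs_nonneg _).trans (le_max_right _ _)
  have hM := hL.M_pos
  have hDM : ∀ r, M ≤ r → |D r| ≤ K := fun r hr =>
    (hL.antitone_deriv self_mem_Ici hr hr).trans (le_max_right _ _)
  -- Constant up to a point beyond `M`, then equal to `|D|`, which decreases there. `K` dominates
  -- `|D|` on `[u, M + 1]` and, through `|D M|`, on `[M, ∞)`.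
  set ψ : ℝ → ℝ := fun r => if r ≤ M + 1 then K else |D r| with hψ
  have hanti : Antitone ψ := by
    intro r r' hrr'
    simp only [hψ]
    split_ifs with h1 h2 h2
    · exact le_rfl
    · linarith
    · exact hDM r' (by linarith)
    · exact hL.antitone_deriv (by simp only [mem_Ici]; linarith) (by simp only [mem_Ici]; linarith)
        hrr'
  have hnn : ∀ r, 0 ≤ ψ r := fun r => by
    simp only [hψ]; split_ifs; exacts [hKnn, abs_nonneg _]
  have hle : ∀ r, ψ r ≤ K := fun r => by
    simp only [hψ]; split_ifs with h; exacts [le_rfl, hDM r (by linarith)]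
  refine ⟨ψ, hanti, hnn, fun r hr => ?_, ?_⟩
  · simp only [hψ]
    split_ifs with h
    · exact (hK₀ ⟨r, ⟨hr, h⟩, rfl⟩).trans (le_max_left _ _)
    · exact le_rfl
  · have hmeas : Measurable fun y : ℝ => ψ (y - 1) ^ 2 :=
      (hanti.measurable.comp (measurable_id.sub_const 1)).pow_const 2
    rw [integrable_fun_norm_addHaar (volume : Measure Plane) (f := fun y => ψ (y - 1) ^ 2)]
    simp only [finrank_euclideanSpace, Fintype.card_fin, Nat.add_one_sub_one, pow_one, smul_eq_mul]
    have hpos : (0 : ℝ) ≤ M + 2 := by linarith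
    rw [← Ioc_union_Ioi_eq_Ioi hpos]
    refine IntegrableOn.union ?_ ?_
    · refine Measure.integrableOn_of_bounded (M := (M + 2) * K ^ 2) (by simp)
        (measurable_id.mul hmeas).aestronglyMeasurable ?_
      refine (ae_restrict_iff' measurableSet_Ioc).2 (ae_of_all _ fun y hy => ?_)
      rw [Real.norm_eq_abs, abs_of_nonneg (mul_nonneg hy.1.le (sq_nonneg _))]
      have := hle (y - 1)
      have := hnn (y - 1)
      have := hy.1
      have := hy.2
      gcongr
    · have h1 : IntegrableOn (fun r : ℝ => D r ^ 2 * r) (Ioi (M + 1)) :=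
        hL.integrable_deriv.mono_set (Ioi_subset_Ioi (by linarith))
      have h2 : IntegrableOn (fun y : ℝ => D (y - 1) ^ 2 * (y - 1)) (Ioi (M + 2)) := by
        have hmp : MeasurePreserving (fun y : ℝ => y - 1) volume volume :=
          measurePreserving_sub_right volume 1
        have hpre : (fun y : ℝ => y - 1) ⁻¹' Ioi (M + 1) = Ioi (M + 2) := by
          ext y; simp only [mem_preimage, mem_Ioi]; constructor <;> intro h <;> linarith
        rw [← hpre]
        exact (hmp.integrableOn_comp_preimage
          (MeasurableEquiv.subRight (1 : ℝ)).measurableEmbedding).2 h1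
      refine Integrable.mono' (h2.const_mul ((M + 2) / (M + 1)))
        (measurable_id.mul hmeas).aestronglyMeasurable ?_
      refine (ae_restrict_iff' measurableSet_Ioi).2 (ae_of_all _ fun y hy => ?_)
      have hy' : M + 2 < y := hy
      have e : ψ (y - 1) = |D (y - 1)| := by
        simp only [hψ]; rw [if_neg]; linarith
      rw [Real.norm_eq_abs, abs_of_nonneg (mul_nonneg (by linarith) (sq_nonneg _)), e, sq_abs,
        mul_comm, mul_left_comm]
      gcongr
      -- For `y > M + 2` the shift costs only a factor: `y ≤ (M + 2)/(M + 1) * (y - 1)`.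
      rw [div_mul_eq_mul_div, le_div_iff₀ (by linarith)]
      nlinarith

lemma KernelAssumptions.abs_profile_sub_le (hL : KernelAssumptions α L M) {u : ℝ} (hu : 0 < u)
    {ψ : ℝ → ℝ} (hψ : Antitone ψ) (hψD : ∀ r, u ≤ r → |deriv (profile α L) r| ≤ ψ r)
    {r p q : ℝ} (hrp : r ≤ p) (hrq : r ≤ q) (hup : u ≤ p) (huq : u ≤ q) :
    |profile α L p - profile α L q| ≤ ψ r * |p - q| := by
  refine (convex_Ici (max u r)).norm_image_sub_le_of_norm_hasDerivWithin_le
    (f := profile α L) (f' := deriv (profile α L)) (fun x hx => ?_) (fun x hx => ?_)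
    (max_le huq hrq) (max_le hup hrp)
  · have hx0 : 0 < x := hu.trans_le ((le_max_left _ _).trans hx)
    rw [(hL.hasDerivAt_profile hx0).deriv]
    exact (hL.hasDerivAt_profile hx0).hasDerivWithinAt
  · exact (hψD x ((le_max_left _ _).trans hx)).trans (hψ ((le_max_right _ _).trans hx))

end Profile

/-! ### An integrable bound for squared increments of scaled kernels. -/

section Dominator

/-- A truncated power of the norm, singular at the origin. -/
noncomputable def innerPower (a : ℝ) (y : Plane) : ℝ := if ‖y‖ ≤ 2 then ‖y‖ ^ (2 * a) else 0

/-- A truncated power of the norm, decaying at infinity. -/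
noncomputable def outerPower (b : ℝ) (y : Plane) : ℝ :=
  if 3 / 2 < ‖y‖ then (2 / 3 * ‖y‖) ^ (2 * b) else 0

/-- The function dominating the squared increments of scaled kernels. -/
noncomputable def dominator (a b : ℝ) (e x : Plane) : ℝ :=
  2 * innerPower a (x + (1 / 2 : ℝ) • e) + 2 * innerPower a (x - (1 / 2 : ℝ) • e) + outerPower b x

lemma innerPower_nonneg (a : ℝ) (y : Plane) : 0 ≤ innerPower a y := by
  unfold innerPower; split_ifs <;> positivity

lemma outerPower_nonneg (b : ℝ) (y : Plane) : 0 ≤ outerPower b y := by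
  unfold outerPower; split_ifs <;> positivity

lemma dominator_nonneg (a b : ℝ) (e x : Plane) : 0 ≤ dominator a b e x := by
  have := innerPower_nonneg a (x + (1 / 2 : ℝ) • e)
  have := innerPower_nonneg a (x - (1 / 2 : ℝ) • e)
  have := outerPower_nonneg b x
  unfold dominator; positivity

lemma integrable_innerPower {a : ℝ} (ha : -1 < a) : Integrable (innerPower a) volume := by
  have h := (integrable_fun_norm_addHaar (volume : Measure Plane)
    (f := fun y : ℝ => if y ≤ 2 then y ^ (2 * a) else 0)).2 ?_
  · exact h
  simp only [finrank_euclideanSpace, Fintype.card_fin, Nat.add_one_sub_one, pow_one, smul_eq_mul]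
  rw [← Ioc_union_Ioi_eq_Ioi (zero_le_two (α := ℝ))]
  refine IntegrableOn.union ?_ ?_
  · have h1 : IntegrableOn (fun y : ℝ => y ^ (2 * a + 1)) (Ioc 0 2) := by
      have := intervalIntegral.intervalIntegrable_rpow' (a := 0) (b := 2) (r := 2 * a + 1)
        (by linarith)
      rwa [intervalIntegrable_iff_integrableOn_Ioc_of_le zero_le_two] at this
    refine h1.congr_fun (fun y hy => ?_) measurableSet_Ioc
    simp only [if_pos hy.2]
    rw [Real.rpow_add_one hy.1.ne', mul_comm]
  · refine (integrableOn_zero).congr_fun (fun y hy => ?_) measurableSet_Ioi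
    simp [not_le.2 (mem_Ioi.1 hy)]

lemma integrable_outerPower {b : ℝ} (hb : b < -1) : Integrable (outerPower b) volume := by
  have h := (integrable_fun_norm_addHaar (volume : Measure Plane)
    (f := fun y : ℝ => if 3 / 2 < y then (2 / 3 * y) ^ (2 * b) else 0)).2 ?_
  · exact h
  simp only [finrank_euclideanSpace, Fintype.card_fin, Nat.add_one_sub_one, pow_one, smul_eq_mul]
  rw [← Ioc_union_Ioi_eq_Ioi (show (0 : ℝ) ≤ 3 / 2 by norm_num)]
  refine IntegrableOn.union ?_ ?_
  · refine (integrableOn_zero).congr_fun (fun y hy => ?_) measurableSet_Ioc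
    simp [not_lt.2 hy.2]
  · have h1 : IntegrableOn (fun y : ℝ => y ^ (2 * b + 1)) (Ioi (3 / 2)) :=
      integrableOn_Ioi_rpow_of_lt (by linarith) (by norm_num)
    refine IntegrableOn.congr_fun (h1.const_mul ((2 / 3 : ℝ) ^ (2 * b))) (fun y hy => ?_)
      measurableSet_Ioi
    have hy' : (3 / 2 : ℝ) < y := hy
    have hy0 : (0 : ℝ) < y := by linarith
    simp only [if_pos hy']
    rw [Real.rpow_add_one hy0.ne', Real.mul_rpow (by norm_num) hy0.le]
    ring

lemma integrable_dominator {a b : ℝ} (ha : -1 < a) (hb : b < -1) (e : Plane) :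
    Integrable (dominator a b e) volume :=
  ((((integrable_innerPower ha).comp_add_right _).const_mul 2).add
    (((integrable_innerPower ha).comp_sub_right _).const_mul 2)).add (integrable_outerPower hb)

lemma integral_dominator {a b : ℝ} (ha : -1 < a) (hb : b < -1) (e : Plane) :
    ∫ x, dominator a b e x = 4 * (∫ x, innerPower a x) + ∫ x, outerPower b x := by
  have h1 := ((integrable_innerPower ha).comp_add_right ((1 / 2 : ℝ) • e)).const_mul 2
  have h2 := ((integrable_innerPower ha).comp_sub_right ((1 / 2 : ℝ) • e)).const_mul 2
  have h3 : dominator a b e = fun x => ((fun x => 2 * innerPower a (x + (1 / 2 : ℝ) • e))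
    + fun x => 2 * innerPower a (x - (1 / 2 : ℝ) • e)) x + outerPower b x := rfl
  have h4 := integral_add h1 h2
  rw [h3, integral_add (h1.add h2) (integrable_outerPower hb)]
  simp only [Pi.add_apply]
  rw [h4, integral_const_mul, integral_const_mul, integral_add_right_eq_self,
    integral_sub_right_eq_self]
  ring

lemma sq_rpow_eq {y a : ℝ} (hy : 0 ≤ y) : (y ^ a) ^ 2 = y ^ (2 * a) := by
  rw [← Real.rpow_natCast, ← Real.rpow_mul hy, mul_comm]; norm_num

/-- For `‖x‖ ≤ 3/2` the two values are bounded separately, by `(u - v)² ≤ 2u² + 2v²`; farther out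
the mean value theorem applies, the two norms differing by at most `1`. Integrability in the plane
needs `a > -1` at the singularities and `b < -1` at infinity. -/
lemma sq_increment_le_dominator {f : ℝ → ℝ} {a b h A : ℝ} (hh : 0 < h)
    (hb : b ≤ 0) (hf : ∀ x, 0 < x → DifferentiableAt ℝ f x)
    (h1 : ∀ y, 0 < y → y ≤ 2 → h * y ≤ 1 → |f (h * y)| ≤ A * y ^ a)
    (h2 : ∀ y, 1 ≤ y → h * y ≤ 1 → |h * deriv f (h * y)| ≤ A * y ^ b)
    {e x : Plane} (he : ‖e‖ = 1) (hx : x + (1 / 2 : ℝ) • e ≠ 0) (hx' : x - (1 / 2 : ℝ) • e ≠ 0)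
    (hxh : h * (‖x‖ + 1 / 2) ≤ 1) :
    (f (h * ‖x + (1 / 2 : ℝ) • e‖) - f (h * ‖x - (1 / 2 : ℝ) • e‖)) ^ 2
      ≤ A ^ 2 * dominator a b e x := by
  set p := ‖x + (1 / 2 : ℝ) • e‖ with hp
  set q := ‖x - (1 / 2 : ℝ) • e‖ with hq
  have he2 : ‖(1 / 2 : ℝ) • e‖ = 1 / 2 := by rw [norm_smul, he]; norm_num
  have hp0 : 0 < p := norm_pos_iff.2 hx
  have hq0 : 0 < q := norm_pos_iff.2 hx'
  have hp1 : p ≤ ‖x‖ + 1 / 2 := (norm_add_le _ _).trans_eq (by rw [he2])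
  have hq1 : q ≤ ‖x‖ + 1 / 2 := (norm_sub_le _ _).trans_eq (by rw [he2])
  have hp2 : ‖x‖ - 1 / 2 ≤ p := by
    have := norm_sub_norm_le x (-((1 / 2 : ℝ) • e)); rwa [norm_neg, he2, sub_neg_eq_add] at this
  have hq2 : ‖x‖ - 1 / 2 ≤ q := by
    have := norm_sub_norm_le x ((1 / 2 : ℝ) • e); rwa [he2] at this
  have hpq : |p - q| ≤ 1 := by
    refine (abs_norm_sub_norm_le _ _).trans ?_
    have : x + (1 / 2 : ℝ) • e - (x - (1 / 2 : ℝ) • e) = e := by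
      rw [add_sub_sub_cancel, ← add_smul]; norm_num
    rw [this, he]
  have hph : h * p ≤ 1 := (mul_le_mul_of_nonneg_left hp1 hh.le).trans hxh
  have hqh : h * q ≤ 1 := (mul_le_mul_of_nonneg_left hq1 hh.le).trans hxh
  rcases le_or_gt ‖x‖ (3 / 2) with hx32 | hx32
  · have ep : innerPower a (x + (1 / 2 : ℝ) • e) = (p ^ a) ^ 2 := by
      rw [sq_rpow_eq hp0.le, innerPower, if_pos (by linarith)]
    have eq : innerPower a (x - (1 / 2 : ℝ) • e) = (q ^ a) ^ 2 := by
      rw [sq_rpow_eq hq0.le, innerPower, if_pos (by linarith)]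
    have b1 := sq_le_sq' (neg_le_of_abs_le (h1 p hp0 (by linarith) hph))
      (le_of_abs_le (h1 p hp0 (by linarith) hph))
    have b2 := sq_le_sq' (neg_le_of_abs_le (h1 q hq0 (by linarith) hqh))
      (le_of_abs_le (h1 q hq0 (by linarith) hqh))
    have h3 := mul_nonneg (sq_nonneg A) (outerPower_nonneg b x)
    rw [dominator, ep, eq]
    nlinarith [sq_nonneg (f (h * p) + f (h * q))]
  -- For `‖x‖ > 3/2` one has `‖x‖ - 1/2 ≥ (2/3)‖x‖ ≥ 1`, so both norms lie above `r` and the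
  -- derivative bound holds between them.
  · set r := 2 / 3 * ‖x‖ with hr
    have hr1 : 1 ≤ r := by rw [hr]; linarith
    have hr0 : 0 < r := by linarith
    have hrp : r ≤ p := by rw [hr]; linarith
    have hrq : r ≤ q := by rw [hr]; linarith
    have hA : 0 ≤ A * r ^ b := (abs_nonneg _).trans
      (h2 r hr1 ((mul_le_mul_of_nonneg_left hrp hh.le).trans hph))
    have hA0 : 0 ≤ A := nonneg_of_mul_nonneg_left hA (Real.rpow_pos_of_pos hr0 b)
    have key : |f (h * p) - f (h * q)| ≤ A * r ^ b * |p - q| := by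
      refine (convex_Icc r h⁻¹).norm_image_sub_le_of_norm_hasDerivWithin_le
        (f := fun y => f (h * y)) (f' := fun y => h * deriv f (h * y))
        (fun y hy => ?_) (fun y hy => ?_) ⟨hrq, ?_⟩ ⟨hrp, ?_⟩
      · have hy0 : 0 < y := hr0.trans_le hy.1
        have := (hf (h * y) (mul_pos hh hy0)).hasDerivAt.comp y ((hasDerivAt_id y).const_mul h)
        rw [mul_one, mul_comm] at this
        exact this.hasDerivWithinAt
      · have hy1 : h * y ≤ 1 := by
          have := mul_le_mul_of_nonneg_left hy.2 hh.le
          rwa [mul_inv_cancel₀ hh.ne'] at this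
        refine (h2 y (hr1.trans hy.1) hy1).trans ?_
        exact mul_le_mul_of_nonneg_left (Real.rpow_le_rpow_of_nonpos hr0 hy.1 hb) hA0
      · rw [← one_div, le_div_iff₀ hh, mul_comm]; exact hqh
      · rw [← one_div, le_div_iff₀ hh, mul_comm]; exact hph
    have key2 : |f (h * p) - f (h * q)| ≤ A * r ^ b :=
      key.trans (mul_le_of_le_one_right hA hpq)
    have b1 := sq_le_sq' (neg_le_of_abs_le key2) (le_of_abs_le key2)
    refine b1.trans ?_
    rw [mul_pow]
    refine mul_le_mul_of_nonneg_left ?_ (sq_nonneg A)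
    rw [sq_rpow_eq hr0.le, dominator, outerPower, if_pos hx32]
    have := innerPower_nonneg a (x + (1 / 2 : ℝ) • e)
    have := innerPower_nonneg a (x - (1 / 2 : ℝ) • e)
    rw [← hr]
    linarith

end Dominator

/-! ### The squared norm of the kernel increments: invariance, splitting, asymptotics. -/

section Increment

variable {α M : ℝ} {L : ℝ → ℝ}

/-- The squared `L²` norm of the increment `s ↦ g (t - s) - g (-s)` of the kernel. -/
noncomputable def kernelIncrement (α : ℝ) (L : ℝ → ℝ) (t : Plane) : ℝ≥0∞ :=
  ∫⁻ s, ‖kernel α L (t - s) - kernel α L (-s)‖ₑ ^ 2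

lemma lintegral_kernel_sub (t t' : Plane) :
    ∫⁻ s, ‖kernel α L (t - s) - kernel α L (t' - s)‖ₑ ^ 2 = kernelIncrement α L (t - t') := by
  have h := lintegral_add_right_eq_self (μ := (volume : Measure Plane))
    (fun s => ‖kernel α L (t - s) - kernel α L (t' - s)‖ₑ ^ 2) t'
  rw [← h, kernelIncrement]
  refine lintegral_congr fun s => ?_
  congr 4 <;> abel_nf

/-- The reflection across the line orthogonal to `t - t'` maps `t` to `t'`, and preserves both the
radial kernel and Lebesgue measure. -/
lemma kernelIncrement_eq_of_norm_eq {t t' : Plane} (h : ‖t‖ = ‖t'‖) :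
    kernelIncrement α L t = kernelIncrement α L t' := by
  set R := (Submodule.span ℝ {t - t'})ᗮ.reflection with hR
  have hRt : R t = t' := Submodule.reflection_sub h
  have hk : ∀ x, kernel α L (R x) = kernel α L x := fun x => by
    simp [kernel, R.norm_map]
  have hmp := (R.measurePreserving (F := Plane)).lintegral_comp_emb
    (R.toHomeomorph.measurableEmbedding)
    (fun s => ‖kernel α L (t' - s) - kernel α L (-s)‖ₑ ^ 2)
  rw [kernelIncrement, kernelIncrement, ← hmp]
  refine lintegral_congr fun s => ?_
  rw [← hRt, ← map_sub, ← map_neg, hk, hk]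

lemma lintegral_comp_smul_plane {φ : Plane → ℝ≥0∞} (hφ : Measurable φ) {h : ℝ} (hh : 0 < h) :
    ∫⁻ y, φ y = ENNReal.ofReal (h ^ 2) * ∫⁻ x, φ (h • x) := by
  have h1 := Measure.map_addHaar_smul (volume : Measure Plane) hh.ne'
  have h2 : ∫⁻ x, φ (h • x) = ∫⁻ y, φ y ∂(Measure.map (h • ·) (volume : Measure Plane)) := by
    rw [lintegral_map hφ (measurable_const_smul h)]
  rw [h2, h1, lintegral_smul_measure, smul_eq_mul, ← mul_assoc, ← ENNReal.ofReal_mul (sq_nonneg h)]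
  rw [finrank_euclideanSpace, Fintype.card_fin, abs_of_pos (by positivity),
    mul_inv_cancel₀ (by positivity), ENNReal.ofReal_one, one_mul]

/-- The part of `kernelIncrement` close to the singularities, after scaling. -/
noncomputable def nearIncrement (α : ℝ) (L : ℝ → ℝ) (h : ℝ) (e : Plane) : ℝ≥0∞ :=
  ∫⁻ x in {x : Plane | h * (‖x‖ + 1 / 2) ≤ 1},
    ‖profile α L (h * ‖x + (1 / 2 : ℝ) • e‖) - profile α L (h * ‖x - (1 / 2 : ℝ) • e‖)‖ₑ ^ 2

/-- The part of `kernelIncrement` far from the singularities. -/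
noncomputable def farIncrement (α : ℝ) (L : ℝ → ℝ) (h : ℝ) (e : Plane) : ℝ≥0∞ :=
  ∫⁻ y in {y : Plane | ‖y‖ + h / 2 ≤ 1}ᶜ,
    ‖kernel α L (y + (h / 2) • e) - kernel α L (y - (h / 2) • e)‖ₑ ^ 2

lemma measurableSet_norm_le (h c : ℝ) : MeasurableSet {x : Plane | h * (‖x‖ + c) ≤ 1} :=
  measurableSet_le (by fun_prop) measurable_const

/-- A translation puts the singularities at `±(h/2)e`. Only the part where both arguments stay in
the unit ball is rescaled, since the bounds on `L` are available on `(0, 1]` only. -/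
lemma KernelAssumptions.kernelIncrement_eq (hL : KernelAssumptions α L M) {h : ℝ} (hh : 0 < h)
    (e : Plane) : kernelIncrement α L (h • e)
      = ENNReal.ofReal (h ^ 2) * nearIncrement α L h e + farIncrement α L h e := by
  set φ : Plane → ℝ≥0∞ := fun y =>
    ‖kernel α L (y + (h / 2) • e) - kernel α L (y - (h / 2) • e)‖ₑ ^ 2 with hφ
  have hφm : Measurable φ :=
    ((hL.measurable_kernel.comp (measurable_id.add_const _)).sub
      (hL.measurable_kernel.comp (measurable_id.sub_const _))).enorm.pow_const 2
  set N : Set Plane := {y | ‖y‖ + h / 2 ≤ 1} with hN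
  have hNm : MeasurableSet N := measurableSet_le (by fun_prop) measurable_const
  have h1 : kernelIncrement α L (h • e) = ∫⁻ y, φ y := by
    have h2 := lintegral_sub_left_eq_self (μ := (volume : Measure Plane)) φ ((h / 2) • e)
    rw [← h2, kernelIncrement]
    refine lintegral_congr fun s => ?_
    simp only [hφ]
    have e1 : (h / 2) • e - s + (h / 2) • e = h • e - s := by
      rw [sub_add_eq_add_sub, ← add_smul]; norm_num
    have e2 : (h / 2) • e - s - (h / 2) • e = -s := by abel
    rw [e1, e2]
  rw [h1, ← lintegral_add_compl φ hNm]
  congr 1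
  rw [← lintegral_indicator hNm, lintegral_comp_smul_plane (hφm.indicator hNm) hh, nearIncrement,
    ← lintegral_indicator (measurableSet_norm_le h (1 / 2))]
  congr 1
  refine lintegral_congr fun x => ?_
  have hmem : h • x ∈ N ↔ x ∈ {x : Plane | h * (‖x‖ + 1 / 2) ≤ 1} := by
    simp only [hN, Set.mem_ofPred_eq, norm_smul, Real.norm_eq_abs, abs_of_pos hh, mul_add,
      mul_one_div]
  have e1 : h • x + (h / 2) • e = h • (x + (1 / 2 : ℝ) • e) := by
    rw [smul_add, smul_smul, mul_one_div]
  have e2 : h • x - (h / 2) • e = h • (x - (1 / 2 : ℝ) • e) := by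
    rw [smul_sub, smul_smul, mul_one_div]
  by_cases hx : x ∈ {x : Plane | h * (‖x‖ + 1 / 2) ≤ 1}
  · rw [indicator_of_mem hx, indicator_of_mem (hmem.2 hx)]
    simp only [hφ, e1, e2, kernel, norm_smul, Real.norm_eq_abs, abs_of_pos hh]
  · rw [indicator_of_notMem hx, indicator_of_notMem (fun h' => hx (hmem.1 h'))]

lemma enorm_sq_eq_ofReal (x : ℝ) : ‖x‖ₑ ^ 2 = ENNReal.ofReal (x ^ 2) := by
  rw [← sq_abs, ENNReal.ofReal_pow (abs_nonneg _), Real.enorm_eq_ofReal_abs]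

/-- There `‖y‖ > 1 - h/2`, so both arguments have norm above `1 - h ≥ 1/2`, and at least `‖y‖ - 1`:
the increment is at most `h` times the majorant. -/
lemma KernelAssumptions.farIncrement_le (hL : KernelAssumptions α L M) :
    ∃ K : ℝ, 0 ≤ K ∧ ∀ h ∈ Ioc (0 : ℝ) (1 / 2), ∀ e : Plane, ‖e‖ = 1 →
      farIncrement α L h e ≤ ENNReal.ofReal (h ^ 2 * K) := by
  obtain ⟨ψ, hanti, hnn, hD, hint⟩ := hL.exists_antitone_majorant (u := 1 / 2) (by norm_num)
  refine ⟨∫ y : Plane, ψ (‖y‖ - 1) ^ 2, integral_nonneg fun _ => sq_nonneg _,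
    fun h hh e he => ?_⟩
  rw [ENNReal.ofReal_mul (sq_nonneg h), ofReal_integral_eq_lintegral_ofReal hint
    (ae_of_all _ fun _ => sq_nonneg _), ← lintegral_const_mul' _ _ ENNReal.ofReal_ne_top]
  refine le_trans ?_ (setLIntegral_le_lintegral {y : Plane | ‖y‖ + h / 2 ≤ 1}ᶜ _)
  refine setLIntegral_mono' ?_ fun y hy => ?_
  · exact (measurableSet_le (by fun_prop) measurable_const).compl
  have hy' : 1 < ‖y‖ + h / 2 := by simpa using hy
  rw [enorm_sq_eq_ofReal, ← ENNReal.ofReal_mul (sq_nonneg h)]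
  refine ENNReal.ofReal_le_ofReal ?_
  have hn : ‖(h / 2) • e‖ = h / 2 := by
    rw [norm_smul, he, mul_one, Real.norm_eq_abs, abs_of_pos (by linarith [hh.1])]
  have hh1 := hh.1
  have hh2 := hh.2
  have hp : ‖y‖ - h / 2 ≤ ‖y + (h / 2) • e‖ := by
    have := norm_sub_norm_le y (-((h / 2) • e)); rwa [norm_neg, hn, sub_neg_eq_add] at this
  have hq : ‖y‖ - h / 2 ≤ ‖y - (h / 2) • e‖ := by
    have := norm_sub_norm_le y ((h / 2) • e); rwa [hn] at this
  have hpq : |‖y + (h / 2) • e‖ - ‖y - (h / 2) • e‖| ≤ h := by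
    refine (abs_norm_sub_norm_le _ _).trans ?_
    have : y + (h / 2) • e - (y - (h / 2) • e) = h • e := by
      rw [add_sub_sub_cancel, ← add_smul]; norm_num
    rw [this, norm_smul, he, mul_one, Real.norm_eq_abs, abs_of_pos hh1]
  have key := hL.abs_profile_sub_le (by norm_num) hanti hD (r := ‖y‖ - 1)
    (p := ‖y + (h / 2) • e‖) (q := ‖y - (h / 2) • e‖) (by linarith) (by linarith) (by linarith)
    (by linarith)
  have key2 : |kernel α L (y + (h / 2) • e) - kernel α L (y - (h / 2) • e)| ≤ ψ (‖y‖ - 1) * h :=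
    key.trans (mul_le_mul_of_nonneg_left hpq (hnn _))
  have := sq_le_sq' (neg_le_of_abs_le key2) (le_of_abs_le key2)
  linarith [mul_pow (ψ (‖y‖ - 1)) h 2]

lemma ae_ne (z : Plane) : ∀ᵐ x : Plane, x ≠ z := by
  simp [ae_iff]

lemma ae_add_sub_ne (e : Plane) :
    ∀ᵐ x : Plane, x + (1 / 2 : ℝ) • e ≠ 0 ∧ x - (1 / 2 : ℝ) • e ≠ 0 := by
  filter_upwards [ae_ne (-((1 / 2 : ℝ) • e)), ae_ne ((1 / 2 : ℝ) • e)] with x h1 h2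
  exact ⟨fun h => h1 (eq_neg_of_add_eq_zero_left h), fun h => h2 (sub_eq_zero.1 h)⟩

lemma KernelAssumptions.differentiableAt_profile (hL : KernelAssumptions α L M) (x : ℝ)
    (hx : 0 < x) : DifferentiableAt ℝ (profile α L) x := (hL.hasDerivAt_profile hx).differentiableAt

lemma KernelAssumptions.nearIncrement_le (hL : KernelAssumptions α L M) {a b h A : ℝ} (hh : 0 < h)
    (ha : -1 < a) (hb : b < -1)
    (h1 : ∀ y, 0 < y → y ≤ 2 → h * y ≤ 1 → |profile α L (h * y)| ≤ A * y ^ a)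
    (h2 : ∀ y, 1 ≤ y → h * y ≤ 1 → |h * deriv (profile α L) (h * y)| ≤ A * y ^ b)
    {e : Plane} (he : ‖e‖ = 1) :
    nearIncrement α L h e ≤ ENNReal.ofReal (A ^ 2 * ∫ x, dominator a b e x) := by
  rw [ENNReal.ofReal_mul (sq_nonneg A), ofReal_integral_eq_lintegral_ofReal
    (integrable_dominator ha hb e) (ae_of_all _ fun _ => dominator_nonneg _ _ _ _),
    ← lintegral_const_mul' _ _ ENNReal.ofReal_ne_top]
  refine le_trans ?_ (setLIntegral_le_lintegral {x : Plane | h * (‖x‖ + 1 / 2) ≤ 1} _)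
  refine lintegral_mono_ae ?_
  refine (ae_restrict_iff' (measurableSet_norm_le h _)).2 ?_
  filter_upwards [ae_add_sub_ne e] with x hx hxh
  rw [enorm_sq_eq_ofReal, ← ENNReal.ofReal_mul (sq_nonneg A)]
  exact ENNReal.ofReal_le_ofReal (sq_increment_le_dominator hh (by linarith)
    hL.differentiableAt_profile h1 h2 he hx.1 hx.2 hxh)

/-- The variance of the kernel increments has order `2 * γ` for every `γ < α + 1`. -/
lemma KernelAssumptions.kernelIncrement_le (hL : KernelAssumptions α L M) {γ : ℝ}
    (hγ0 : 0 < γ) (hγ : γ < α + 1) :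
    ∃ C : ℝ, 0 ≤ C ∧ ∀ t : Plane, t ≠ 0 → ‖t‖ ≤ 1 / 2 →
      kernelIncrement α L t ≤ ENNReal.ofReal (C * ‖t‖ ^ (2 * γ)) := by
  have hα0 := hL.lt_zero
  obtain ⟨K, hK0, hK⟩ := hL.farIncrement_le
  -- This `η` turns the exponent `α - η` into `a = γ - 1 > -1`; and `a - 1 < -1` because `γ < α + 1
  -- < 1`.
  obtain ⟨A, hA, hbd⟩ := hL.profile_bounds (η := α - (γ - 1)) (by linarith)
  rw [sub_sub_cancel] at hbd
  set a := γ - 1 with ha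
  set D := 4 * (∫ x, innerPower a x) + ∫ x, outerPower (a - 1) x with hD
  have hD0 : 0 ≤ D := by
    have h1 := integral_nonneg (μ := (volume : Measure Plane)) (f := innerPower a)
      fun y => innerPower_nonneg a y
    have h2 := integral_nonneg (μ := (volume : Measure Plane)) (f := outerPower (a - 1))
      fun y => outerPower_nonneg (a - 1) y
    positivity
  refine ⟨A ^ 2 * D + K, by positivity, fun t ht0 ht => ?_⟩
  set h := ‖t‖ with hh
  have hh0 : 0 < h := norm_pos_iff.2 ht0
  set e := h⁻¹ • t with he
  have he1 : ‖e‖ = 1 := norm_smul_inv_norm ht0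
  have hte : t = h • e := by rw [he, smul_smul, mul_inv_cancel₀ hh0.ne', one_smul]
  have hnear := hL.nearIncrement_le (a := a) (b := a - 1) (A := A * h ^ a) hh0 (by linarith)
    (by linarith)
    (fun y hy _ hy1 => ((hbd (h * y) ⟨mul_pos hh0 hy, hy1⟩).1).trans_eq (by
      rw [Real.mul_rpow hh0.le hy.le]; ring))
    (fun y hy hy1 => by
      have hy0 : 0 < y := by linarith
      rw [abs_mul, abs_of_pos hh0]
      refine (mul_le_mul_of_nonneg_left (hbd (h * y) ⟨mul_pos hh0 hy0, hy1⟩).2 hh0.le).trans_eq ?_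
      have : h ^ a = h ^ (a - 1) * h := by rw [← Real.rpow_add_one hh0.ne']; ring_nf
      rw [Real.mul_rpow hh0.le hy0.le, this]; ring) he1
  rw [integral_dominator (by linarith) (by linarith)] at hnear
  have hfar := hK h ⟨hh0, ht⟩ e he1
  rw [hte, hL.kernelIncrement_eq hh0]
  refine (add_le_add (mul_le_mul_right hnear _) hfar).trans ?_
  rw [← ENNReal.ofReal_mul (sq_nonneg h), ← ENNReal.ofReal_add (by positivity) (by positivity)]
  refine ENNReal.ofReal_le_ofReal ?_
  have e1 : h ^ 2 * (h ^ a) ^ 2 = h ^ (2 * γ) := by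
    rw [sq_rpow_eq hh0.le, ← Real.rpow_natCast, ← Real.rpow_add hh0]
    congr 1; rw [ha]; push_cast; ring
  have e2 : h ^ 2 ≤ h ^ (2 * γ) := by
    rw [← Real.rpow_natCast]
    exact Real.rpow_le_rpow_of_exponent_ge hh0 (by linarith) (by push_cast; linarith)
  calc h ^ 2 * ((A * h ^ a) ^ 2 * D) + h ^ 2 * K
      = A ^ 2 * D * (h ^ 2 * (h ^ a) ^ 2) + K * h ^ 2 := by ring
    _ ≤ A ^ 2 * D * h ^ (2 * γ) + K * h ^ (2 * γ) := by rw [e1]; gcongr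
    _ = _ := by ring

/-- The scaling limit of the variance of the kernel increments. -/
lemma KernelAssumptions.tendsto_kernelIncrement (hL : KernelAssumptions α L M)
    (hc : ∃ c : ℝ, 0 < c ∧ ∀ x ∈ Ioc (0 : ℝ) 1, c ≤ L x) {e : Plane} (he : ‖e‖ = 1) :
    Integrable (fun x : Plane =>
        (‖x + (1 / 2 : ℝ) • e‖ ^ α - ‖x - (1 / 2 : ℝ) • e‖ ^ α) ^ 2) volume ∧
      Tendsto (fun h : ℝ => h ^ (-2 - 2 * α) * ((L h) ^ 2)⁻¹ * (kernelIncrement α L (h • e)).toReal)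
        (𝓝[>] 0) (𝓝 (∫ x : Plane,
          (‖x + (1 / 2 : ℝ) • e‖ ^ α - ‖x - (1 / 2 : ℝ) • e‖ ^ α) ^ 2)) := by
  have hα := hL.neg_one_lt
  have hα0 := hL.lt_zero
  obtain ⟨c, hc0, hcL⟩ := hc
  obtain ⟨K, hK0, hK⟩ := hL.farIncrement_le
  -- Chosen to give `α - η > -1` and `α + η - 1 < -1`, the two integrability conditions on the
  -- dominating function.
  set η := min (-α / 2) ((α + 1) / 2) with hη
  have hη0 : 0 < η := lt_min (by linarith) (by linarith)
  have hη1 : η ≤ -α / 2 := min_le_left _ _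
  have hη2 : η ≤ (α + 1) / 2 := min_le_right _ _
  obtain ⟨A, hA, hbd⟩ := hL.scaled_profile_bounds hc0 hcL hη0
  set a := α - η with ha
  set b := α + η - 1 with hb
  have ha1 : -1 < a := by rw [ha]; linarith
  have hb1 : b < -1 := by rw [hb]; linarith
  set D : ℝ → Plane → ℝ := fun h x =>
    profile α L (h * ‖x + (1 / 2 : ℝ) • e‖) - profile α L (h * ‖x - (1 / 2 : ℝ) • e‖) with hD
  set N : ℝ → ℝ := fun h => h ^ α * L h with hN
  set S : ℝ → Set Plane := fun h => {x : Plane | h * (‖x‖ + 1 / 2) ≤ 1} with hS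
  set F : ℝ → Plane → ℝ := fun h => (S h).indicator fun x => ((N h) ^ 2)⁻¹ * (D h x) ^ 2 with hF
  set G : Plane → ℝ := fun x =>
    (‖x + (1 / 2 : ℝ) • e‖ ^ α - ‖x - (1 / 2 : ℝ) • e‖ ^ α) ^ 2 with hG
  have hNpos : ∀ h, 0 < h → 0 < N h := fun h hh =>
    mul_pos (Real.rpow_pos_of_pos hh α) (hL.pos h hh)
  have hDm : ∀ h, 0 < h → Measurable (D h) := by
    intro h hh
    have hk : ∀ z : Plane, profile α L (h * ‖z‖) = kernel α L (h • z) := fun z => by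
      rw [kernel, norm_smul, Real.norm_eq_abs, abs_of_pos hh]
    simp only [hD, hk]
    exact (hL.measurable_kernel.comp (by fun_prop)).sub (hL.measurable_kernel.comp (by fun_prop))
  have hFm : ∀ h, 0 < h → Measurable (F h) := fun h hh =>
    (((hDm h hh).pow_const 2).const_mul _).indicator (measurableSet_norm_le h _)
  have hsmall : ∀ᶠ h : ℝ in 𝓝[>] 0, h ∈ Ioc (0 : ℝ) (1 / 2) :=
    Ioc_mem_nhdsGT (by norm_num)
  have hFbound : ∀ h ∈ Ioc (0 : ℝ) (1 / 2), ∀ᵐ x : Plane, ‖F h x‖ ≤ A ^ 2 * dominator a b e x := by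
    intro h hh
    have hh1 : h ∈ Ioc (0 : ℝ) 1 := ⟨hh.1, hh.2.trans (by norm_num)⟩
    filter_upwards [ae_add_sub_ne e] with x hx
    by_cases hxS : x ∈ S h
    · have hN0 := hNpos h hh.1
      simp only [hF]
      rw [indicator_of_mem hxS, Real.norm_eq_abs, abs_of_nonneg (by positivity),
        inv_mul_le_iff₀ (by positivity)]
      refine (sq_increment_le_dominator (A := A * N h) hh.1 (by linarith)
        hL.differentiableAt_profile (hbd h hh1).1 (hbd h hh1).2 he hx.1 hx.2 hxS).trans_eq ?_
      ring
    · simp only [hF]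
      rw [indicator_of_notMem hxS, norm_zero]
      exact mul_nonneg (sq_nonneg A) (dominator_nonneg _ _ _ _)
  have hratio : ∀ y, 0 < y → Tendsto (fun h => profile α L (h * y) / N h) (𝓝[>] 0)
      (𝓝 (y ^ α)) := by
    intro y hy
    have h1 := (hL.slowlyVarying y hy).const_mul (y ^ α)
    rw [mul_one] at h1
    refine h1.congr' ?_
    filter_upwards [self_mem_nhdsWithin] with h hh
    have hh0 : 0 < h := hh
    have := hL.pos h hh0
    have := Real.rpow_pos_of_pos hh0 α
    simp only [hN]
    rw [profile, Real.mul_rpow hh0.le hy.le, mul_comm y h]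
    field_simp
  have hFlim : ∀ᵐ x : Plane, Tendsto (fun h => F h x) (𝓝[>] 0) (𝓝 (G x)) := by
    filter_upwards [ae_add_sub_ne e] with x hx
    have h1 := ((hratio _ (norm_pos_iff.2 hx.1)).sub (hratio _ (norm_pos_iff.2 hx.2))).pow 2
    refine h1.congr' ?_
    have hmem : ∀ᶠ h : ℝ in 𝓝[>] 0, x ∈ S h := by
      have : Tendsto (fun h : ℝ => h * (‖x‖ + 1 / 2)) (𝓝[>] 0) (𝓝 (0 * (‖x‖ + 1 / 2))) :=
        (tendsto_nhdsWithin_of_tendsto_nhds tendsto_id).mul_const _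
      rw [zero_mul] at this
      exact this.eventually_le_const one_pos
    filter_upwards [hmem] with h hh
    simp only [hF]
    rw [indicator_of_mem hh, ← sub_div, div_pow, div_eq_inv_mul]
  have hdom : Integrable (fun x => A ^ 2 * dominator a b e x) volume :=
    (integrable_dominator ha1 hb1 e).const_mul _
  have hGint : Integrable G volume := by
    refine hdom.mono' (Measurable.aestronglyMeasurable ?_) ?_
    · simp only [hG]
      fun_prop
    -- The exceptional null set depends on `h`, so the bound is passed to the limit along a
    -- sequence.
    · obtain ⟨u, hu⟩ := exists_seq_tendsto (𝓝[>] (0 : ℝ))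
      obtain ⟨n₀, hn₀⟩ := eventually_atTop.1 (hu.eventually hsmall)
      have hall : ∀ᵐ x : Plane, ∀ n, n₀ ≤ n → ‖F (u n) x‖ ≤ A ^ 2 * dominator a b e x :=
        ae_all_iff.2 fun n => by
          by_cases hn : n₀ ≤ n
          · filter_upwards [hFbound (u n) (hn₀ n hn)] with x hx _ using hx
          · exact ae_of_all _ fun x h => absurd h hn
      filter_upwards [hFlim, hall] with x hx hx'
      exact le_of_tendsto ((hx.comp hu).norm) (eventually_atTop.2 ⟨n₀, hx'⟩)
  refine ⟨hGint, ?_⟩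
  have hDCT : Tendsto (fun h => ∫ x, F h x) (𝓝[>] 0) (𝓝 (∫ x, G x)) := by
    refine tendsto_integral_filter_of_dominated_convergence _ ?_ ?_ hdom hFlim
    · filter_upwards [hsmall] with h hh using (hFm h hh.1).aestronglyMeasurable
    · filter_upwards [hsmall] with h hh using hFbound h hh
  have hfar : Tendsto (fun h : ℝ => h ^ (-2 - 2 * α) * ((L h) ^ 2)⁻¹ * (farIncrement α L h e).toReal)
      (𝓝[>] 0) (𝓝 0) := by
    -- The far part is `O(h²)`; after normalisation there remains `h^(-2α)`, which tends to `0`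
    -- because `α < 0`.
    have hlim : Tendsto (fun h : ℝ => (c ^ 2)⁻¹ * K * h ^ (-2 * α)) (𝓝[>] 0) (𝓝 0) := by
      have h1 : Tendsto (fun h : ℝ => h ^ (-2 * α)) (𝓝[>] 0) (𝓝 (0 ^ (-2 * α))) :=
        ((Real.continuousAt_rpow_const 0 (-2 * α) (Or.inr (by linarith))).tendsto).mono_left
          nhdsWithin_le_nhds
      rw [Real.zero_rpow (by linarith)] at h1
      simpa using h1.const_mul ((c ^ 2)⁻¹ * K)
    refine tendsto_of_tendsto_of_tendsto_of_le_of_le' tendsto_const_nhds hlim ?_ ?_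
    · filter_upwards [hsmall] with h hh
      have := hh.1
      positivity
    · filter_upwards [hsmall] with h hh
      have hh0 := hh.1
      have h1 : (farIncrement α L h e).toReal ≤ h ^ 2 * K :=
        ENNReal.toReal_le_of_le_ofReal (by positivity) (hK h hh e he)
      have h2 : c ≤ L h := hcL h ⟨hh.1, hh.2.trans (by norm_num)⟩
      calc h ^ (-2 - 2 * α) * ((L h) ^ 2)⁻¹ * (farIncrement α L h e).toReal
          ≤ h ^ (-2 - 2 * α) * (c ^ 2)⁻¹ * (h ^ 2 * K) := by gcongr
        _ = (c ^ 2)⁻¹ * K * (h ^ (-2 - 2 * α) * h ^ (2 : ℝ)) := by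
            rw [← Real.rpow_natCast h 2]; push_cast; ring
        _ = _ := by rw [← Real.rpow_add hh0]; ring_nf
  have hsum := hDCT.add hfar
  rw [add_zero] at hsum
  refine hsum.congr' ?_
  filter_upwards [hsmall] with h hh
  have hh0 := hh.1
  have hh1 : h ∈ Ioc (0 : ℝ) 1 := ⟨hh.1, hh.2.trans (by norm_num)⟩
  have hnearfin : nearIncrement α L h e ≠ ∞ := ne_top_of_le_ne_top ENNReal.ofReal_ne_top
    (hL.nearIncrement_le (A := A * N h) hh0 ha1 hb1 (hbd h hh1).1 (hbd h hh1).2 he)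
  have hfarfin : farIncrement α L h e ≠ ∞ := ne_top_of_le_ne_top ENNReal.ofReal_ne_top (hK h hh e he)
  rw [hL.kernelIncrement_eq hh0, ENNReal.toReal_add (ENNReal.mul_ne_top ENNReal.ofReal_ne_top
    hnearfin) hfarfin, ENNReal.toReal_mul, ENNReal.toReal_ofReal (sq_nonneg h), mul_add]
  congr 1
  have hnear : (nearIncrement α L h e).toReal = ∫ x, (S h).indicator (fun x => (D h x) ^ 2) x := by
    rw [integral_indicator (measurableSet_norm_le h _), integral_eq_lintegral_of_nonneg_ae
      (ae_of_all _ fun _ => sq_nonneg _) ((hDm h hh0).pow_const 2).aestronglyMeasurable]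
    simp only [← enorm_sq_eq_ofReal]
    rfl
  have hFeq : ∀ x, F h x = ((N h) ^ 2)⁻¹ * (S h).indicator (fun x => (D h x) ^ 2) x := fun x => by
    simp only [hF]
    by_cases hx : x ∈ S h
    · rw [indicator_of_mem hx, indicator_of_mem hx]
    · rw [indicator_of_notMem hx, indicator_of_notMem hx, mul_zero]
  simp only [hFeq]
  rw [integral_const_mul, hnear, ← mul_assoc]
  congr 1
  have hr : h ^ (-2 - 2 * α) = (h ^ 2)⁻¹ * ((h ^ α) ^ 2)⁻¹ := by
    rw [sq_rpow_eq hh0.le, Real.rpow_sub hh0, Real.rpow_neg hh0.le, div_eq_mul_inv]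
    norm_num
  simp only [hN]
  rw [hr, mul_pow, mul_inv]
  field_simp

end Increment

/-! ### Dyadic grids in the plane. -/

section Grid

/-- The points of the dyadic grid of level `k`. -/
noncomputable def gridPoint (k : ℕ) (z : Fin 2 → ℤ) : Plane :=
  WithLp.toLp 2 fun i => (z i : ℝ) / 2 ^ k

/-- The index of the lower left corner of the dyadic square of level `k` containing `x`. -/
noncomputable def gridFloor (k : ℕ) (x : Plane) : Fin 2 → ℤ := fun i => ⌊2 ^ k * x i⌋

/-- The dyadic approximation of level `k`. -/
noncomputable def gridApprox (k : ℕ) (x : Plane) : Plane := gridPoint k (gridFloor k x)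

/-- The dyadic points of the plane. -/
def dyadic : Set Plane := {d | ∃ k z, d = gridPoint k z}

lemma gridPoint_apply (k : ℕ) (z : Fin 2 → ℤ) (i : Fin 2) : gridPoint k z i = (z i : ℝ) / 2 ^ k :=
  rfl

lemma gridApprox_mem (k : ℕ) (x : Plane) : gridApprox k x ∈ dyadic := ⟨k, _, rfl⟩

lemma plane_dist_le {x y : Plane} {c : ℝ} (h : ∀ i, |x i - y i| ≤ c) : dist x y ≤ 2 * c := by
  have hc : 0 ≤ c := (abs_nonneg _).trans (h 0)
  rw [EuclideanSpace.dist_eq]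
  refine Real.sqrt_le_iff.2 ⟨by positivity, ?_⟩
  rw [Fin.sum_univ_two, Real.dist_eq, Real.dist_eq]
  have h0 := pow_le_pow_left₀ (abs_nonneg _) (h 0) 2
  have h1 := pow_le_pow_left₀ (abs_nonneg _) (h 1) 2
  nlinarith [sq_nonneg c]

lemma abs_coord_sub_le_dist (x y : Plane) (i : Fin 2) : |x i - y i| ≤ dist x y := by
  rw [dist_eq_norm]
  have := PiLp.norm_apply_le (x - y) i
  simpa using this

lemma dist_gridApprox_le (k : ℕ) (x : Plane) : dist x (gridApprox k x) ≤ 2 * (1 / 2) ^ k := by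
  refine plane_dist_le fun i => ?_
  rw [gridApprox, gridPoint_apply, gridFloor]
  have h2 : (0 : ℝ) < 2 ^ k := by positivity
  have h1 := Int.floor_le (2 ^ k * x i)
  have h3 := Int.lt_floor_add_one (2 ^ k * x i)
  have e : x i - (⌊2 ^ k * x i⌋ : ℝ) / 2 ^ k = (2 ^ k * x i - ⌊2 ^ k * x i⌋) / 2 ^ k := by
    field_simp
  rw [e, abs_div, abs_of_nonneg (by linarith), abs_of_pos h2, one_div, inv_pow, div_eq_mul_inv]
  refine mul_le_of_le_one_left (by positivity) (by linarith)

lemma tendsto_gridApprox (x : Plane) : Tendsto (fun k => gridApprox k x) atTop (𝓝 x) := by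
  rw [tendsto_iff_dist_tendsto_zero]
  have : Tendsto (fun k : ℕ => 2 * (1 / 2 : ℝ) ^ k) atTop (𝓝 0) := by
    simpa using (tendsto_pow_atTop_nhds_zero_of_lt_one (r := (1 / 2 : ℝ)) (by norm_num)
      (by norm_num)).const_mul 2
  refine squeeze_zero (fun _ => dist_nonneg) (fun k => ?_) this
  rw [dist_comm]
  exact dist_gridApprox_le k x

lemma gridPoint_add (k m : ℕ) (z : Fin 2 → ℤ) :
    gridPoint k z = gridPoint (k + m) fun i => 2 ^ m * z i := by
  ext i
  simp only [gridPoint_apply]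
  push_cast
  rw [pow_add]
  field_simp

lemma gridApprox_eq_of_mem {d : Plane} (hd : d ∈ dyadic) :
    ∃ n, ∀ m, n ≤ m → gridApprox m d = d := by
  obtain ⟨n, z, rfl⟩ := hd
  refine ⟨n, fun m hm => ?_⟩
  obtain ⟨j, rfl⟩ := Nat.exists_eq_add_of_le hm
  rw [gridPoint_add n j z, gridApprox]
  congr 1
  ext i
  rw [gridFloor, gridPoint_apply, mul_div_cancel₀ _ (by positivity), Int.floor_intCast]

/-- Two dyadic points of level `k` which are equal or adjacent. -/
def GridNeighbors (k : ℕ) (p q : Plane) : Prop :=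
  ∃ z u : Fin 2 → ℤ, (∀ i, |u i| ≤ 1) ∧ p = gridPoint k z ∧ q = gridPoint k (z + u)

/-- A point of level `k` is a point of level `k + 1` with doubled index, and `⌊2y⌋ - 2⌊y⌋` is `0` or
`1`. -/
lemma gridNeighbors_succ (k : ℕ) (x : Plane) :
    GridNeighbors (k + 1) (gridApprox k x) (gridApprox (k + 1) x) := by
  refine ⟨fun i => 2 ^ 1 * gridFloor k x i,
    fun i => gridFloor (k + 1) x i - 2 ^ 1 * gridFloor k x i, fun i => ?_,
    gridPoint_add k 1 _, ?_⟩
  · have h1 := Int.floor_le (2 ^ k * x i)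
    have h2 := Int.lt_floor_add_one (2 ^ k * x i)
    have e : (2 : ℝ) ^ (k + 1) * x i = 2 * (2 ^ k * x i) := by ring
    have h3 : 2 * ⌊2 ^ k * x i⌋ ≤ ⌊(2 : ℝ) ^ (k + 1) * x i⌋ := by
      rw [Int.le_floor, e]; push_cast; linarith
    have h4 : ⌊(2 : ℝ) ^ (k + 1) * x i⌋ < 2 * ⌊2 ^ k * x i⌋ + 2 := by
      rw [Int.floor_lt, e]; push_cast; linarith
    simp only [gridFloor, pow_one]
    rw [abs_le]
    constructor <;> omega
  · rw [gridApprox]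
    congr 1
    ext i
    simp

lemma gridNeighbors_of_dist {k : ℕ} {x y : Plane} (h : dist x y ≤ (1 / 2) ^ k) :
    GridNeighbors k (gridApprox k x) (gridApprox k y) := by
  refine ⟨gridFloor k x, gridFloor k y - gridFloor k x, fun i => ?_, rfl, ?_⟩
  · have h0 := (abs_coord_sub_le_dist x y i).trans h
    have h2 : (0 : ℝ) < 2 ^ k := by positivity
    have h3 : |2 ^ k * x i - 2 ^ k * y i| ≤ 1 := by
      rw [← mul_sub, abs_mul, abs_of_pos h2]
      calc 2 ^ k * |x i - y i| ≤ 2 ^ k * (1 / 2) ^ k := by gcongr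
        _ = 1 := by rw [← mul_pow]; norm_num
    have a1 := Int.floor_le (2 ^ k * x i)
    have a2 := Int.lt_floor_add_one (2 ^ k * x i)
    have b1 := Int.floor_le (2 ^ k * y i)
    have b2 := Int.lt_floor_add_one (2 ^ k * y i)
    obtain ⟨c1, c2⟩ := abs_le.1 h3
    simp only [Pi.sub_apply, gridFloor]
    have d1 : ((⌊2 ^ k * y i⌋ - ⌊2 ^ k * x i⌋ : ℤ) : ℝ) < (2 : ℤ) := by push_cast; linarith
    have d2 : ((-2 : ℤ) : ℝ) < ((⌊2 ^ k * y i⌋ - ⌊2 ^ k * x i⌋ : ℤ) : ℝ) := by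
      push_cast; linarith
    rw [Int.cast_lt] at d1 d2
    rw [abs_le]
    constructor <;> omega
  · rw [gridApprox]
    congr 1
    simp

lemma GridNeighbors.dist_le {k : ℕ} {p q : Plane} (h : GridNeighbors k p q) :
    dist p q ≤ 2 * (1 / 2) ^ k := by
  obtain ⟨z, u, hu, rfl, rfl⟩ := h
  refine plane_dist_le fun i => ?_
  rw [gridPoint_apply, gridPoint_apply, Pi.add_apply, ← sub_div, abs_div, Int.cast_add,
    sub_add_cancel_left, abs_neg, abs_of_pos (show (0 : ℝ) < 2 ^ k by positivity), one_div, inv_pow,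
    div_eq_mul_inv]
  refine mul_le_of_le_one_left (by positivity) ?_
  have := Int.cast_le (R := ℝ).2 (hu i)
  simpa using this

end Grid

/-! ### Chaining: from neighbouring grid points to Hölder continuity. -/

section Chaining

/-- Hölder continuity, at small distances, on the dyadic points of a ball. -/
def DyadicHolder (γ : ℝ) (f : Plane → ℝ) (x : Plane) (r : ℝ) : Prop :=
  ∃ C ρ : ℝ, 0 ≤ C ∧ 0 < ρ ∧ ∀ d ∈ dyadic ∩ Metric.ball x r, ∀ d' ∈ dyadic ∩ Metric.ball x r,
    dist d d' < ρ → |f d - f d'| ≤ C * dist d d' ^ γ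

/-- Two points at distance about `2⁻ⁿ` have neighbouring approximations of level `n`, and successive
approximations of one point are neighbours, so the increments sum to a geometric series of order
`θⁿ`. For dyadic points the telescoping is finite, so no continuity of `f` is needed. The radius is
halved to keep the approximations inside the larger ball. -/
lemma dyadicHolder_of_neighbors {γ : ℝ} (hγ : 0 < γ) {f : Plane → ℝ} {x : Plane} {R : ℝ}
    (hR : 0 < R) (h : ∀ᶠ k : ℕ in atTop, ∀ p ∈ Metric.ball x R, ∀ q ∈ Metric.ball x R,
      GridNeighbors k p q → |f p - f q| ≤ ((1 / 2 : ℝ) ^ γ) ^ k) :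
    DyadicHolder γ f x (R / 2) := by
  set θ := (1 / 2 : ℝ) ^ γ with hθ
  have hθ0 : 0 < θ := by positivity
  have hθ1 : θ < 1 := Real.rpow_lt_one (by norm_num) (by norm_num) hγ
  have hsmall : ∀ᶠ k : ℕ in atTop, 2 * (1 / 2 : ℝ) ^ k < R / 2 := by
    have : Tendsto (fun k : ℕ => 2 * (1 / 2 : ℝ) ^ k) atTop (𝓝 0) := by
      simpa using (tendsto_pow_atTop_nhds_zero_of_lt_one (r := (1 / 2 : ℝ)) (by norm_num)
        (by norm_num)).const_mul 2
    exact this.eventually_lt_const (by linarith)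
  obtain ⟨k₀, hk₀⟩ := eventually_atTop.1 (h.and hsmall)
  have hball : ∀ d ∈ Metric.ball x (R / 2), ∀ k, k₀ ≤ k → gridApprox k d ∈ Metric.ball x R := by
    intro d hd k hk
    have h1 := dist_gridApprox_le k d
    have h2 := (hk₀ k hk).2
    rw [Metric.mem_ball] at hd ⊢
    have := dist_triangle (gridApprox k d) d x
    rw [dist_comm] at h1
    linarith
  have hchain : ∀ d ∈ Metric.ball x (R / 2), ∀ k, k₀ ≤ k → ∀ m,
      |f (gridApprox (k + m) d) - f (gridApprox k d)| ≤ ∑ j ∈ Finset.range m, θ ^ (k + j) := by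
    intro d hd k hk m
    induction m with
    | zero => simp
    | succ m ih =>
      rw [Finset.sum_range_succ]
      have h1 := (hk₀ (k + m + 1) (by omega)).1 _ (hball d hd (k + m) (by omega)) _
        (hball d hd (k + m + 1) (by omega)) (gridNeighbors_succ (k + m) d)
      have h2 : θ ^ (k + m + 1) ≤ θ ^ (k + m) := by
        rw [pow_succ]; exact mul_le_of_le_one_right (by positivity) hθ1.le
      have h3 := abs_sub_le (f (gridApprox (k + (m + 1)) d)) (f (gridApprox (k + m) d))
        (f (gridApprox k d))
      rw [abs_sub_comm] at h1
      rw [← add_assoc] at h3 ⊢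
      linarith
  have hgeom : ∀ k m : ℕ, ∑ j ∈ Finset.range m, θ ^ (k + j) ≤ θ ^ k * (1 - θ)⁻¹ := by
    intro k m
    simp_rw [pow_add, ← Finset.mul_sum]
    refine mul_le_mul_of_nonneg_left ?_ (by positivity)
    rw [← tsum_geometric_of_lt_one hθ0.le hθ1]
    exact (summable_geometric_of_lt_one hθ0.le hθ1).sum_le_tsum _ fun _ _ => by positivity
  have happrox : ∀ d ∈ dyadic ∩ Metric.ball x (R / 2), ∀ k, k₀ ≤ k →
      |f d - f (gridApprox k d)| ≤ θ ^ k * (1 - θ)⁻¹ := by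
    intro d hd k hk
    obtain ⟨n, hn⟩ := gridApprox_eq_of_mem hd.1
    have := (hchain d hd.2 k hk n).trans (hgeom k n)
    rwa [hn (k + n) (by omega)] at this
  have h1θ : 0 < (1 - θ)⁻¹ := inv_pos.2 (by linarith)
  refine ⟨(2 * (1 - θ)⁻¹ + 1) * 2 ^ γ, (1 / 2) ^ k₀, by positivity, by positivity,
    fun d hd d' hd' hdd' => ?_⟩
  rcases (dist_nonneg (x := d) (y := d')).eq_or_lt with h0 | h0
  · rw [dist_eq_zero.1 h0.symm, sub_self, abs_zero]
    positivity
  -- The level with `2^(-(n+1)) < dist d d' ≤ 2⁻ⁿ`. Distances below `2^(-k₀)` force `n ≥ k₀`, and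
  -- the gap of one level costs the factor `2^γ`.
  · obtain ⟨n, hn1, hn2⟩ := exists_nat_pow_near_of_lt_one h0
      (hdd'.le.trans (pow_le_one₀ (by norm_num) (by norm_num)))
      (show (0 : ℝ) < 1 / 2 by norm_num) (by norm_num)
    have hnk : k₀ ≤ n := by
      have := (pow_lt_pow_iff_right_of_lt_one₀ (show (0 : ℝ) < 1 / 2 by norm_num)
        (by norm_num)).1 (hn1.trans hdd')
      omega
    have h1 := (hk₀ n hnk).1 _ (hball d hd.2 n hnk) _ (hball d' hd'.2 n hnk)
      (gridNeighbors_of_dist hn2)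
    have h2 := happrox d hd n hnk
    have h3 := happrox d' hd' n hnk
    have h4 : |f d - f d'| ≤ (2 * (1 - θ)⁻¹ + 1) * θ ^ n := by
      have e : f d - f d' = (f d - f (gridApprox n d)) + (f (gridApprox n d) - f (gridApprox n d'))
        - (f d' - f (gridApprox n d')) := by ring
      rw [e]
      refine (abs_sub _ _).trans ?_
      have := abs_add_le (f d - f (gridApprox n d)) (f (gridApprox n d) - f (gridApprox n d'))
      linarith
    have h5 : θ ^ n ≤ 2 ^ γ * dist d d' ^ γ := by
      have e : θ ^ n = 2 ^ γ * ((1 / 2) ^ (n + 1)) ^ γ := by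
        rw [← Real.mul_rpow (by norm_num) (by positivity), hθ, ← Real.rpow_natCast,
          ← Real.rpow_mul (by norm_num), mul_comm γ, Real.rpow_mul (by norm_num),
          Real.rpow_natCast]
        congr 1
        ring
      rw [e]
      gcongr
    calc _ ≤ _ := h4
      _ ≤ (2 * (1 - θ)⁻¹ + 1) * (2 ^ γ * dist d d' ^ γ) := by gcongr
      _ = _ := by ring

/-- The limit of a function along the dyadic approximations of a point. -/
noncomputable def dyadicLimit (f : Plane → ℝ) (t : Plane) : ℝ :=
  limUnder atTop fun k => f (gridApprox k t)

variable {γ : ℝ} {f : Plane → ℝ} {x : Plane} {r : ℝ}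

lemma DyadicHolder.tendsto (h : DyadicHolder γ f x r) (hγ : 0 < γ) {t : Plane}
    (ht : t ∈ Metric.ball x r) :
    Tendsto (fun k => f (gridApprox k t)) atTop (𝓝 (dyadicLimit f t)) := by
  obtain ⟨C, ρ, hC, hρ, h⟩ := h
  refine tendsto_nhds_limUnder (cauchySeq_tendsto_of_complete <| Metric.cauchySeq_iff.2 fun ε hε => ?_)
  have hc : CauchySeq fun k => gridApprox k t := (tendsto_gridApprox t).cauchySeq
  have hlim : Tendsto (fun u : ℝ => C * u ^ γ) (𝓝 0) (𝓝 0) := by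
    have := ((Real.continuousAt_rpow_const 0 γ (Or.inr hγ.le)).tendsto).const_mul C
    rwa [Real.zero_rpow hγ.ne', mul_zero] at this
  obtain ⟨δ, hδ, hδ'⟩ := Metric.eventually_nhds_iff.1 (hlim.eventually_lt_const hε)
  obtain ⟨N₁, hN₁⟩ := Metric.cauchySeq_iff.1 hc (min δ ρ) (lt_min hδ hρ)
  obtain ⟨N₂, hN₂⟩ := eventually_atTop.1
    ((tendsto_gridApprox t).eventually_mem (Metric.isOpen_ball.mem_nhds ht))
  refine ⟨max N₁ N₂, fun m hm n hn => ?_⟩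
  have hd := hN₁ m (le_of_max_le_left hm) n (le_of_max_le_left hn)
  refine (h _ ⟨gridApprox_mem m t, hN₂ m (le_of_max_le_right hm)⟩ _
    ⟨gridApprox_mem n t, hN₂ n (le_of_max_le_right hn)⟩ (hd.trans_le (min_le_right _ _))).trans_lt ?_
  refine hδ' ?_
  rw [Real.dist_0_eq_abs, abs_of_nonneg dist_nonneg]
  exact hd.trans_le (min_le_left _ _)

lemma DyadicHolder.exists_bound (h : DyadicHolder γ f x r) (hγ : 0 < γ) :
    ∃ C ρ : ℝ, 0 ≤ C ∧ 0 < ρ ∧ ∀ t ∈ Metric.ball x r, ∀ t' ∈ Metric.ball x r, dist t t' < ρ →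
      |dyadicLimit f t - dyadicLimit f t'| ≤ C * dist t t' ^ γ := by
  have hlim := fun t (ht : t ∈ Metric.ball x r) => h.tendsto hγ ht
  obtain ⟨C, ρ, hC, hρ, h⟩ := h
  refine ⟨C, ρ, hC, hρ, fun t ht t' ht' htt' => ?_⟩
  have hd : Tendsto (fun k => dist (gridApprox k t) (gridApprox k t')) atTop (𝓝 (dist t t')) :=
    (tendsto_gridApprox t).dist (tendsto_gridApprox t')
  refine le_of_tendsto_of_tendsto ((hlim t ht).sub (hlim t' ht')).abs
    ((((Real.continuous_rpow_const hγ.le).tendsto _).comp hd).const_mul C) ?_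
  filter_upwards [(tendsto_gridApprox t).eventually_mem (Metric.isOpen_ball.mem_nhds ht),
    (tendsto_gridApprox t').eventually_mem (Metric.isOpen_ball.mem_nhds ht'),
    hd.eventually_lt_const htt'] with k h1 h2 h3
  exact h _ ⟨gridApprox_mem k t, h1⟩ _ ⟨gridApprox_mem k t', h2⟩ h3

lemma locallyHolderOn_of_dyadicHolder {U : Set Plane} (hγ : 0 < γ)
    (h : ∀ t ∈ U, ∃ x r, t ∈ Metric.ball x r ∧ DyadicHolder γ f x r) :
    LocallyHolderOn γ (dyadicLimit f) U := by
  intro t ht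
  obtain ⟨x, r, htx, hd⟩ := h t ht
  obtain ⟨C, ρ, hC, hρ, h⟩ := hd.exists_bound hγ
  refine ⟨C.toNNReal, Metric.ball x r ∩ Metric.ball t (ρ / 2), mem_nhdsWithin_of_mem_nhds
    (Filter.inter_mem (Metric.isOpen_ball.mem_nhds htx) (Metric.ball_mem_nhds t (by linarith))), ?_⟩
  intro y hy z hz
  have hyz : dist y z < ρ := by
    have := dist_triangle_right y z t
    have h1 := Metric.mem_ball.1 hy.2
    have h2 := Metric.mem_ball.1 hz.2
    linarith
  have := h y hy.1 z hz.1 hyz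
  rw [edist_dist, edist_dist, Real.dist_eq, Real.coe_toNNReal γ hγ.le,
    ENNReal.ofReal_rpow_of_nonneg dist_nonneg hγ.le]
  change _ ≤ ENNReal.ofReal C * _
  rw [← ENNReal.ofReal_mul hC]
  exact ENNReal.ofReal_le_ofReal this

end Chaining

/-! ### Kolmogorov's criterion with random variances, and construction of the version. -/

section Kolmogorov

variable {Ω : Type*} [MeasurableSpace Ω] {P : Measure Ω} {X : Plane → Ω → ℝ}

/-- The indices of the dyadic points of level `k` in a square. -/
noncomputable def gridBox (B k : ℕ) : Finset (Fin 2 → ℤ) :=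
  Finset.Icc (fun _ => -(B * 2 ^ k : ℤ)) fun _ => (B * 2 ^ k : ℤ)

lemma card_gridBox_le {B : ℕ} (hB : 1 ≤ B) (k : ℕ) : (gridBox B k).card ≤ 9 * B ^ 2 * 4 ^ k := by
  have h1 : (gridBox B k).card = (2 * (B * 2 ^ k) + 1) ^ 2 := by
    rw [gridBox, Pi.card_Icc, Fin.prod_univ_two, Int.card_Icc, sq]
    have : (B * 2 ^ k : ℤ) = ((B * 2 ^ k : ℕ) : ℤ) := by push_cast; rfl
    rw [this]
    congr 1 <;> omega
  rw [h1]
  have h2 : 1 ≤ B * 2 ^ k := Nat.one_le_iff_ne_zero.2 (by positivity)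
  calc (2 * (B * 2 ^ k) + 1) ^ 2 ≤ (3 * (B * 2 ^ k)) ^ 2 := by gcongr; omega
    _ = 9 * B ^ 2 * (2 ^ 2) ^ k := by rw [← pow_mul, mul_comm 2 k, pow_mul]; ring
    _ = _ := by norm_num

lemma mem_gridBox {x : Plane} {R : ℝ} {B : ℕ} (hB : ‖x‖ + R ≤ B) {k : ℕ} {z : Fin 2 → ℤ}
    (hz : gridPoint k z ∈ Metric.ball x R) : z ∈ gridBox B k := by
  have h2 : (0 : ℝ) < 2 ^ k := by positivity
  have h : ∀ i, |(z i : ℝ)| ≤ B * 2 ^ k := by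
    intro i
    have h1 := abs_coord_sub_le_dist (gridPoint k z) 0 i
    have h3 := dist_triangle (gridPoint k z) x 0
    rw [dist_zero_right x] at h3
    have h4 := Metric.mem_ball.1 hz
    rw [gridPoint_apply] at h1
    simp only [PiLp.zero_apply, sub_zero, abs_div, abs_of_pos h2] at h1
    rw [div_le_iff₀ h2] at h1
    exact h1.trans (mul_le_mul_of_nonneg_right (by linarith) h2.le)
  rw [gridBox, Finset.mem_Icc]
  constructor
  · intro i
    have := (abs_le.1 (h i)).1
    exact_mod_cast this
  · intro i
    have := (abs_le.1 (h i)).2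
    exact_mod_cast this

/-- A local form of the Kolmogorov continuity criterion, in which the increments are controlled by
random variances `V`. -/
theorem ae_dyadicHolder {V : Plane → Plane → Ω → ℝ≥0∞} {γ γ' : ℝ} (hγ : 0 < γ) (hγγ' : γ < γ')
    (hmom : ∀ m : ℕ, ∃ C : ℝ≥0∞, C ≠ ∞ ∧ ∀ t t' : Plane, ∀ v ρ : ℝ, 0 < v → 0 < ρ →
      P {ω | ρ ≤ |X t ω - X t' ω| ∧ V t t' ω ≤ ENNReal.ofReal v}
        ≤ C * ENNReal.ofReal ((2 * v) ^ m / ρ ^ (2 * m)))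
    {x : Plane} {R : ℝ} (hR : 0 < R)
    (hV : ∀ᵐ ω ∂P, ∃ K : ℝ, ∀ t ∈ Metric.ball x R, ∀ t' ∈ Metric.ball x R, t ≠ t' →
      V t t' ω ≤ ENNReal.ofReal (K * dist t t' ^ (2 * γ'))) :
    ∀ᵐ ω ∂P, DyadicHolder γ (fun t => X t ω) x (R / 2) := by
  -- At level `k` there are of order `4^k` neighbouring pairs, each bad with probability of order
  -- `4^(-k m (γ' - γ))`; the series converges once `m (γ' - γ) > 1`.
  obtain ⟨m, hm⟩ := exists_nat_gt (1 / (γ' - γ))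
  have hmγ : 1 < m * (γ' - γ) := by rwa [div_lt_iff₀ (by linarith)] at hm
  obtain ⟨C, hC, hmom⟩ := hmom m
  obtain ⟨B, hB⟩ := exists_nat_ge (max (‖x‖ + R) 1)
  have hB1 : 1 ≤ B := by exact_mod_cast (le_max_right _ _).trans hB
  set θ := (1 / 2 : ℝ) ^ γ with hθ
  have hθ0 : 0 < θ := by positivity
  -- Integers `N` stand in for the random constant `K`, and `2 * 2⁻ᵏ` bounds the distance of
  -- neighbours. Borel–Cantelli runs for every fixed `N`, and only afterwards is `N ≥ K` chosen for
  -- the given `ω`.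
  set v : ℕ → ℕ → ℝ := fun N k => (N + 1 : ℝ) * (2 * (1 / 2) ^ k) ^ (2 * γ') with hv
  have hv0 : ∀ N k, 0 < v N k := fun N k => by positivity
  set E : ℕ → ℕ → (Fin 2 → ℤ) → (Fin 2 → ℤ) → Set Ω := fun N k z u =>
    {ω | θ ^ k ≤ |X (gridPoint k z) ω - X (gridPoint k (z + u)) ω| ∧
      V (gridPoint k z) (gridPoint k (z + u)) ω ≤ ENNReal.ofReal (v N k)} with hE
  set nb : Finset (Fin 2 → ℤ) := Finset.Icc (fun _ => -1) fun _ => 1 with hnb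
  set bad : ℕ → ℕ → Set Ω := fun N k => ⋃ z ∈ gridBox B k, ⋃ u ∈ nb, E N k z u with hbad
  set q : ℝ := 4 * (1 / 2) ^ (2 * (m * (γ' - γ))) with hq
  have hq0 : 0 ≤ q := by positivity
  have hq1 : q < 1 := by
    have h1 : (1 / 2 : ℝ) ^ (2 * (m * (γ' - γ))) < (1 / 2 : ℝ) ^ (2 : ℝ) :=
      Real.rpow_lt_rpow_of_exponent_gt (by norm_num) (by norm_num) (by linarith)
    have h2 : (1 / 2 : ℝ) ^ (2 : ℝ) = 1 / 4 := by
      rw [show (2 : ℝ) = ((2 : ℕ) : ℝ) by norm_num, Real.rpow_natCast]; norm_num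
    rw [hq]; linarith
  have hbadle : ∀ N k, P (bad N k) ≤ (9 * B ^ 2 * nb.card : ℕ) * C *
      ENNReal.ofReal ((2 * (N + 1) * 2 ^ (2 * γ')) ^ m) * ENNReal.ofReal (q ^ k) := by
    intro N k
    have hE' : ∀ z u, P (E N k z u) ≤ C * ENNReal.ofReal ((2 * v N k) ^ m / (θ ^ k) ^ (2 * m)) :=
      fun z u => hmom _ _ _ _ (hv0 N k) (by positivity)
    have hreal : (2 * v N k) ^ m / (θ ^ k) ^ (2 * m)
        = (2 * (N + 1) * 2 ^ (2 * γ')) ^ m * (q ^ k / 4 ^ k) := by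
      have h2 : (0 : ℝ) < (1 / 2) ^ k := by positivity
      have e1 : ((1 / 2 : ℝ) ^ k) ^ (2 * γ') = ((1 / 2) ^ (2 * γ')) ^ k := by
        rw [← Real.rpow_natCast, ← Real.rpow_mul (by norm_num), mul_comm, Real.rpow_mul (by norm_num),
          Real.rpow_natCast]
      have e2 : q ^ k / 4 ^ k = (((1 / 2 : ℝ) ^ (2 * γ')) ^ k) ^ m / (θ ^ k) ^ (2 * m) := by
        rw [hq, mul_pow, mul_div_assoc, mul_comm, div_mul_cancel₀ _ (by positivity),
          ← pow_mul, ← pow_mul, hθ, ← Real.rpow_natCast, ← Real.rpow_natCast, ← Real.rpow_natCast,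
          ← Real.rpow_mul (by norm_num), ← Real.rpow_mul (by norm_num),
          ← Real.rpow_mul (by norm_num), ← Real.rpow_sub (by norm_num)]
        congr 1
        push_cast
        ring
      simp only [hv]
      rw [e2, Real.mul_rpow (by norm_num) h2.le, e1, ← mul_div_assoc, ← mul_pow]
      congr 2
      ring
    calc P (bad N k) ≤ ∑ z ∈ gridBox B k, P (⋃ u ∈ nb, E N k z u) := measure_biUnion_finset_le _ _
      _ ≤ ∑ z ∈ gridBox B k, ∑ u ∈ nb, P (E N k z u) :=
          Finset.sum_le_sum fun z _ => measure_biUnion_finset_le _ _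
      _ ≤ ∑ z ∈ gridBox B k, ∑ u ∈ nb,
            C * ENNReal.ofReal ((2 * v N k) ^ m / (θ ^ k) ^ (2 * m)) :=
          Finset.sum_le_sum fun z _ => Finset.sum_le_sum fun u _ => hE' z u
      _ = ((gridBox B k).card * nb.card : ℕ) *
            (C * ENNReal.ofReal ((2 * v N k) ^ m / (θ ^ k) ^ (2 * m))) := by
          simp only [Finset.sum_const, nsmul_eq_mul]; push_cast; ring
      _ ≤ (9 * B ^ 2 * 4 ^ k * nb.card : ℕ) *
            (C * ENNReal.ofReal ((2 * v N k) ^ m / (θ ^ k) ^ (2 * m))) := by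
          gcongr
          exact card_gridBox_le hB1 k
      _ = _ := by
          rw [hreal, ENNReal.ofReal_mul (by positivity)]
          have e3 : ENNReal.ofReal (q ^ k) = 4 ^ k * ENNReal.ofReal (q ^ k / 4 ^ k) := by
            rw [show (4 : ℝ≥0∞) ^ k = ENNReal.ofReal (4 ^ k) by
              rw [ENNReal.ofReal_pow (by norm_num)]; norm_num,
              ← ENNReal.ofReal_mul (by positivity), mul_div_cancel₀ _ (by positivity)]
          rw [e3]
          push_cast
          ring
  have hsum : ∀ N, ∑' k, P (bad N k) ≠ ∞ := by
    intro N
    refine ne_top_of_le_ne_top ?_ (ENNReal.tsum_le_tsum (hbadle N))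
    rw [ENNReal.tsum_mul_left]
    refine ENNReal.mul_ne_top (ENNReal.mul_ne_top (ENNReal.mul_ne_top (ENNReal.natCast_ne_top _) hC)
      ENNReal.ofReal_ne_top) ?_
    rw [← ENNReal.ofReal_tsum_of_nonneg (fun k => by positivity)
      (summable_geometric_of_lt_one hq0 hq1)]
    exact ENNReal.ofReal_ne_top
  have hev : ∀ᵐ ω ∂P, ∀ N, ∀ᶠ k in atTop, ω ∉ bad N k :=
    ae_all_iff.2 fun N => ae_eventually_notMem (hsum N)
  filter_upwards [hev, hV] with ω hω ⟨K, hK⟩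
  refine dyadicHolder_of_neighbors hγ hR ?_
  obtain ⟨N, hN⟩ := exists_nat_ge K
  filter_upwards [hω N] with k hk p hp q hq hpq
  have hdist := hpq.dist_le
  rcases eq_or_ne p q with rfl | hne
  · simp only [sub_self, abs_zero]; positivity
  have hVpq := hK p hp q hq hne
  obtain ⟨z, u, hu, rfl, rfl⟩ := hpq
  by_contra! hlt
  refine hk (mem_iUnion₂.2 ⟨z, mem_gridBox ((le_max_left _ _).trans hB) hp,
    mem_iUnion₂.2 ⟨u, ?_, hlt.le, hVpq.trans (ENNReal.ofReal_le_ofReal ?_)⟩⟩)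
  · rw [hnb, Finset.mem_Icc]
    exact ⟨fun i => (abs_le.1 (hu i)).1, fun i => (abs_le.1 (hu i)).2⟩
  · have h1 : dist (gridPoint k z) (gridPoint k (z + u)) ^ (2 * γ')
        ≤ (2 * (1 / 2) ^ k) ^ (2 * γ') := by
      have : 0 < γ' := hγ.trans hγγ'
      gcongr
    have h2 : K ≤ N + 1 := by linarith
    simp only [hv]
    calc _ ≤ (N + 1 : ℝ) * dist (gridPoint k z) (gridPoint k (z + u)) ^ (2 * γ') := by gcongr
      _ ≤ _ := by gcongr

/-- Existence of a locally Hölder continuous version on a set. -/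
theorem exists_version {U : Set Plane} {γ : ℝ} (hγ : 0 < γ)
    (hXm : ∀ t, Measurable (X t))
    (hcont : ∀ t ∈ U, TendstoInMeasure P (fun k => X (gridApprox k t)) atTop (X t))
    (h : ∀ x ∈ U, ∃ r : ℝ, 0 < r ∧ ∀ᵐ ω ∂P, DyadicHolder γ (fun t => X t ω) x r) :
    ∃ Y : Plane → Ω → ℝ, IsVersion P X Y ∧ ∀ ω, LocallyHolderOn γ (fun t => Y t ω) U := by
  classical
  choose! r hr0 hr using h
  -- Each ball has its own exceptional null set; a countable subcover keeps their union null.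
  obtain ⟨T, hTU, hTc, hTcover⟩ := TopologicalSpace.countable_cover_nhdsWithin
    (s := U) (f := fun x => Metric.ball x (r x))
    fun x hx => mem_nhdsWithin_of_mem_nhds (Metric.ball_mem_nhds x (hr0 x hx))
  have hae : ∀ᵐ ω ∂P, ∀ x ∈ T, DyadicHolder γ (fun t => X t ω) x (r x) :=
    (ae_ball_iff hTc).2 fun x hx => hr x (hTU hx)
  obtain ⟨G, hGm, hGae, hG⟩ : ∃ G : Set Ω, MeasurableSet G ∧ (∀ᵐ ω ∂P, ω ∈ G) ∧
      ∀ ω ∈ G, ∀ x ∈ T, DyadicHolder γ (fun t => X t ω) x (r x) := by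
    obtain ⟨G, hGae, hGm, hG⟩ := hae.exists_measurable_mem
    exact ⟨G, hGm, hGae, hG⟩
  have hG' : ∀ ω ∈ G, ∀ t ∈ U, ∃ x ρ, t ∈ Metric.ball x ρ ∧ DyadicHolder γ (fun t => X t ω) x ρ := by
    intro ω hω t ht
    obtain ⟨x, hx, htx⟩ := mem_iUnion₂.1 (hTcover ht)
    exact ⟨x, r x, htx, hG ω hω x hx⟩
  -- Zero off the good event `G`, so that every realisation, not almost every one, is Hölder on `U`;
  -- outside `U` nothing is required beyond being a version, and `X` is kept.
  set Y : Plane → Ω → ℝ := fun t ω =>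
    if t ∈ U then (if ω ∈ G then dyadicLimit (fun t => X t ω) t else 0) else X t ω with hY
  have hlim : ∀ t ∈ U, ∀ ω, Tendsto (fun k => G.indicator (X (gridApprox k t)) ω) atTop
      (𝓝 (Y t ω)) := by
    intro t ht ω
    simp only [hY, if_pos ht]
    by_cases hω : ω ∈ G
    · simp only [if_pos hω, indicator_of_mem hω]
      obtain ⟨x, ρ, hx, hd⟩ := hG' ω hω t ht
      exact hd.tendsto hγ hx
    · simp only [if_neg hω, indicator_of_notMem hω]
      exact tendsto_const_nhds
  refine ⟨Y, fun t => ?_, fun ω => ?_⟩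
  · by_cases ht : t ∈ U
    · refine ⟨measurable_of_tendsto_metrizable (fun k => (hXm (gridApprox k t)).indicator hGm)
        (tendsto_pi_nhds.2 (hlim t ht)), ?_⟩
      -- Continuity in measure identifies the dyadic limit with `X t` almost surely, through a
      -- subsequence.
      obtain ⟨ns, hns, hconv⟩ := (hcont t ht).exists_seq_tendsto_ae
      filter_upwards [hGae, hconv] with ω hω h1
      have h2 := (hlim t ht ω).comp hns.tendsto_atTop
      simp only [Function.comp_def, indicator_of_mem hω] at h2
      exact tendsto_nhds_unique h2 h1
    · have : Y t = X t := by ext ω; simp only [hY, if_neg ht]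
      rw [this]
      exact ⟨hXm t, EventuallyEq.rfl⟩
  · have hloc : LocallyHolderOn γ
        (fun t => if ω ∈ G then dyadicLimit (fun t => X t ω) t else 0) U := by
      by_cases hω : ω ∈ G
      · simp only [if_pos hω]
        exact locallyHolderOn_of_dyadicHolder hγ (hG' ω hω)
      · simp only [if_neg hω]
        exact fun t _ => ⟨0, univ, Filter.univ_mem, fun y _ z _ => by simp⟩
    intro t ht
    obtain ⟨C, S, hS, hC⟩ := hloc t ht
    refine ⟨C, S ∩ U, Filter.inter_mem hS self_mem_nhdsWithin, fun y hy z hz => ?_⟩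
    simp only [hY, if_pos hy.2, if_pos hz.2]
    exact hC y hy.1 z hz.1

end Kolmogorov

/-! ### The moving average: variogram, conditional variances, Hölder versions. -/

section MovingAverage

variable {Ω : Type*} [MeasurableSpace Ω] {P : Measure Ω}
  {W : Set Plane → Ω → ℝ} {σ X : Plane → Ω → ℝ} {α M : ℝ} {L : ℝ → ℝ}

lemma IsVolatility.measurable_apply (hσ : IsVolatility P σ) (s : Plane) : Measurable (σ s) :=
  hσ.measurable.comp measurable_prodMk_left

/-- Covariance stationarity at lag `0` makes the variance constant, and the mean is constant too. -/
lemma IsVolatility.integral_sq [IsProbabilityMeasure P] (hσ : IsVolatility P σ) (s : Plane) :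
    ∫ ω, σ s ω ^ 2 ∂P = ∫ ω, σ 0 ω ^ 2 ∂P := by
  have h := hσ.cov s 0
  rw [add_zero, covariance_self (hσ.measurable_apply s).aemeasurable,
    covariance_self (hσ.measurable_apply 0).aemeasurable, variance_eq_sub (hσ.memLp s),
    variance_eq_sub (hσ.memLp 0), hσ.mean s] at h
  simpa using h

lemma IsVolatility.lintegral_sq [IsProbabilityMeasure P] (hσ : IsVolatility P σ) (s : Plane) :
    ∫⁻ ω, ‖σ s ω‖ₑ ^ 2 ∂P = ENNReal.ofReal (∫ ω, σ 0 ω ^ 2 ∂P) := by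
  rw [← hσ.integral_sq s, ofReal_integral_eq_lintegral_ofReal (hσ.memLp s).integrable_sq
    (ae_of_all _ fun _ => sq_nonneg _)]
  simp only [enorm_sq_eq_ofReal]

/-- The expectation of a weighted integral of the squared volatility. -/
lemma IsVolatility.lintegral_lintegral_mul [IsProbabilityMeasure P] (hσ : IsVolatility P σ)
    {φ : Plane → ℝ≥0∞}
    (hφ : Measurable φ) :
    ∫⁻ ω, ∫⁻ s, φ s * ‖σ s ω‖ₑ ^ 2 ∂volume ∂P
      = ENNReal.ofReal (∫ ω, σ 0 ω ^ 2 ∂P) * ∫⁻ s, φ s := by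
  have hm : Measurable fun p : Ω × Plane => φ p.2 * ‖σ p.2 p.1‖ₑ ^ 2 :=
    (hφ.comp measurable_snd).mul ((hσ.measurable.comp measurable_swap).enorm.pow_const 2)
  rw [lintegral_lintegral_swap hm.aemeasurable, mul_comm, ← lintegral_mul_const _ hφ]
  refine lintegral_congr fun s => ?_
  rw [lintegral_const_mul _ ((hσ.measurable_apply s).enorm.pow_const 2), hσ.lintegral_sq]

/-- The variance of the increment `X t - X t'` conditionally on the volatility. -/
noncomputable def condVariance (σ : Plane → Ω → ℝ) (α : ℝ) (L : ℝ → ℝ) (t t' : Plane) (ω : Ω) :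
    ℝ≥0∞ :=
  ∫⁻ s, ‖kernel α L (t - s) * σ s ω - kernel α L (t' - s) * σ s ω‖ₑ ^ 2

lemma measurable_kernel_mul (hL : KernelAssumptions α L M) (hσ : IsVolatility P σ) (t : Plane) :
    Measurable (Function.uncurry fun s ω => kernel α L (t - s) * σ s ω) :=
  (hL.measurable_kernel.comp (measurable_fst.const_sub t)).mul hσ.measurable

lemma measurable_kernel_mul_sub (hL : KernelAssumptions α L M) (hσ : IsVolatility P σ)
    (t t' : Plane) : Measurable (Function.uncurry fun s ω =>
      kernel α L (t - s) * σ s ω - kernel α L (t' - s) * σ s ω) :=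
  (measurable_kernel_mul hL hσ t).sub (measurable_kernel_mul hL hσ t')

lemma lintegral_condVariance [IsProbabilityMeasure P] (hL : KernelAssumptions α L M)
    (hσ : IsVolatility P σ) (t t' : Plane) : ∫⁻ ω, condVariance σ α L t t' ω ∂P
      = ENNReal.ofReal (∫ ω, σ 0 ω ^ 2 ∂P) * kernelIncrement α L (t - t') := by
  have hm : Measurable fun s => ‖kernel α L (t - s) - kernel α L (t' - s)‖ₑ ^ 2 :=
    ((hL.measurable_kernel.comp (measurable_id.const_sub t)).sub
      (hL.measurable_kernel.comp (measurable_id.const_sub t'))).enorm.pow_const 2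
  rw [← lintegral_kernel_sub, ← hσ.lintegral_lintegral_mul hm]
  simp only [condVariance, ← sub_mul, enorm_mul, mul_pow]

lemma IsVMMA.isStochasticIntegral_sub [IsProbabilityMeasure P]
    (hX : IsVMMA P W σ (kernel α L) X) (hL : KernelAssumptions α L M) (hW : IsWhiteNoise P W)
    (hσ : IsVolatility P σ) (t t' : Plane) :
    IsStochasticIntegral (fieldSigma σ) P W
      (fun s ω => kernel α L (t - s) * σ s ω - kernel α L (t' - s) * σ s ω)
      (fun ω => X t ω - X t' ω) :=
  (hX t).sub hσ.measurable_apply hW (measurable_kernel_mul hL hσ t) (measurable_kernel_mul hL hσ t')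
    (hX t')

lemma IsVMMA.lintegral_sub_sq [IsProbabilityMeasure P]
    (hX : IsVMMA P W σ (kernel α L) X) (hL : KernelAssumptions α L M) (hW : IsWhiteNoise P W)
    (hσ : IsVolatility P σ) (hindep : IndepVolNoise P σ W) (t t' : Plane) :
    ∫⁻ ω, ‖X t ω - X t' ω‖ₑ ^ 2 ∂P
      = ENNReal.ofReal (∫ ω, σ 0 ω ^ 2 ∂P) * kernelIncrement α L (t - t') := by
  rw [← lintegral_condVariance hL hσ]
  exact (hX.isStochasticIntegral_sub hL hW hσ t t').isometry hσ.measurable_apply hW hindep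
    (measurable_kernel_mul_sub hL hσ t t')

lemma IsVMMA.integral_sub_sq [IsProbabilityMeasure P]
    (hX : IsVMMA P W σ (kernel α L) X) (hL : KernelAssumptions α L M) (hW : IsWhiteNoise P W)
    (hσ : IsVolatility P σ) (hindep : IndepVolNoise P σ W) (t t' : Plane) :
    ∫ ω, (X t ω - X t' ω) ^ 2 ∂P
      = (∫ ω, σ 0 ω ^ 2 ∂P) * (kernelIncrement α L (t - t')).toReal := by
  have hm : Measurable fun ω => (X t ω - X t' ω) ^ 2 := ((hX t).1.sub (hX t').1).pow_const 2
  rw [integral_eq_lintegral_of_nonneg_ae (ae_of_all _ fun _ => sq_nonneg _)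
    hm.aestronglyMeasurable]
  simp only [← enorm_sq_eq_ofReal]
  rw [hX.lintegral_sub_sq hL hW hσ hindep, ENNReal.toReal_mul,
    ENNReal.toReal_ofReal (integral_nonneg fun _ => sq_nonneg _)]

lemma IsVMMA.tendstoInMeasure [IsProbabilityMeasure P]
    (hX : IsVMMA P W σ (kernel α L) X) (hL : KernelAssumptions α L M) (hW : IsWhiteNoise P W)
    (hσ : IsVolatility P σ) (hindep : IndepVolNoise P σ W) (t : Plane) :
    TendstoInMeasure P (fun k => X (gridApprox k t)) atTop (X t) := by
  refine tendstoInMeasure_of_tendsto_eLpNorm (p := 2) (by norm_num)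
    (fun k => (hX _).1.aestronglyMeasurable) (hX t).1.aestronglyMeasurable ?_
  have hα := hL.neg_one_lt
  obtain ⟨C, hC, hle⟩ := hL.kernelIncrement_le (γ := (α + 1) / 2) (by linarith) (by linarith)
  have hd : Tendsto (fun k => ‖gridApprox k t - t‖) atTop (𝓝 0) :=
    tendsto_iff_norm_sub_tendsto_zero.1 (tendsto_gridApprox t)
  have hlim : Tendsto (fun k => ENNReal.ofReal (C * ‖gridApprox k t - t‖ ^ (2 * ((α + 1) / 2))))
      atTop (𝓝 0) := by
    have h1 := (((Real.continuousAt_rpow_const 0 (2 * ((α + 1) / 2))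
      (Or.inr (by linarith))).tendsto).comp hd).const_mul C
    rw [Real.zero_rpow (by linarith), mul_zero] at h1
    simpa using ENNReal.tendsto_ofReal h1
  have hlim2 : Tendsto (fun k => kernelIncrement α L (gridApprox k t - t)) atTop (𝓝 0) := by
    refine tendsto_of_tendsto_of_tendsto_of_le_of_le' tendsto_const_nhds hlim
      (Eventually.of_forall fun _ => zero_le) ?_
    filter_upwards [hd.eventually_le_const (show (0 : ℝ) < 1 / 2 by norm_num)] with k hk
    by_cases h0 : gridApprox k t - t = 0
    · rw [h0]; simp [kernelIncrement]
    · exact hle _ h0 hk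
  have hlim3 : Tendsto (fun k => ∫⁻ ω, ‖X (gridApprox k t) ω - X t ω‖ₑ ^ 2 ∂P) atTop (𝓝 0) := by
    simp only [hX.lintegral_sub_sq hL hW hσ hindep]
    simpa using ENNReal.Tendsto.const_mul hlim2 (Or.inr ENNReal.ofReal_ne_top)
  have h4 := hlim3.ennrpow_const (1 / 2 : ℝ)
  rw [ENNReal.zero_rpow_of_pos (by norm_num)] at h4
  refine h4.congr fun k => ?_
  rw [eLpNorm_eq_lintegral_rpow_enorm_toReal (by norm_num) (by norm_num)]
  simp

/-- Where the volatility is bounded, the conditional variances of the increments are almost surely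
bounded by a power of the distance. -/
lemma ae_condVariance_le [IsProbabilityMeasure P] (hL : KernelAssumptions α L M)
    (hσ : IsVolatility P σ) {c x : Plane}
    (hB : AEBoundedOn P σ (Metric.closedBall c (M + 1))) (hx : x ∈ Metric.ball c (M + 1)) {γ : ℝ}
    (hγ0 : 0 < γ) (hγ : γ < α + 1) :
    ∃ R : ℝ, 0 < R ∧ ∀ᵐ ω ∂P, ∃ K : ℝ, ∀ t ∈ Metric.ball x R, ∀ t' ∈ Metric.ball x R, t ≠ t' →
      condVariance σ α L t t' ω ≤ ENNReal.ofReal (K * dist t t' ^ (2 * γ)) := by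
  have hα0 := hL.lt_zero
  set δ := M + 1 - dist x c with hδ
  have hδ0 : 0 < δ := sub_pos.2 (Metric.mem_ball.1 hx)
  obtain ⟨C, hC, hle⟩ := hL.kernelIncrement_le hγ0 hγ
  obtain ⟨ψ, hanti, hnn, hD, hint⟩ := hL.exists_antitone_majorant (u := δ / 2) (by linarith)
  -- A point outside the closed ball is farther than `δ` from `x`, hence at least `δ/2` from all
  -- points within `R` of `x`, where the majorant is valid. The bound `1/4` keeps `dist t t' ≤ 1/2`,
  -- the range of `kernelIncrement_le`.
  set R := min (δ / 2) (1 / 4) with hR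
  have hR1 : R ≤ δ / 2 := min_le_left _ _
  have hR2 : R ≤ 1 / 4 := min_le_right _ _
  refine ⟨R, lt_min (by linarith) (by norm_num), ?_⟩
  set φ : Plane → ℝ≥0∞ := fun s => ENNReal.ofReal (ψ (‖x - s‖ - 1) ^ 2) with hφ
  have hφm : Measurable φ := by
    refine ENNReal.measurable_ofReal.comp ((hanti.measurable.comp ?_).pow_const 2)
    fun_prop
  have hφint : ∫⁻ s, φ s ≠ ∞ := (hint.comp_sub_left x).lintegral_lt_top.ne
  -- Outside the ball `σ` need not be bounded; the weighted integral is almost surely finite because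
  -- its mean is `E[σ_0²]` times `∫ φ`.
  have hZ : ∀ᵐ ω ∂P, ∫⁻ s, φ s * ‖σ s ω‖ₑ ^ 2 < ∞ := by
    refine ae_lt_top ?_ ?_
    · exact Measurable.lintegral_prod_left' (f := fun p : Plane × Ω => φ p.1 * ‖σ p.1 p.2‖ₑ ^ 2)
        ((hφm.comp measurable_fst).mul (hσ.measurable.enorm.pow_const 2))
    · rw [hσ.lintegral_lintegral_mul hφm]
      exact ENNReal.mul_ne_top ENNReal.ofReal_ne_top hφint
  filter_upwards [hB, hZ] with ω ⟨S₀, hS₀⟩ hZω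
  set Z := ∫⁻ s, φ s * ‖σ s ω‖ₑ ^ 2 with hZdef
  set S := max S₀ 0 with hS
  have hS0 : 0 ≤ S := le_max_right _ _
  have hSb : ∀ s ∈ Metric.closedBall c (M + 1), σ s ω ^ 2 ≤ S := fun s hs =>
    (hS₀ ⟨s, hs, rfl⟩).trans (le_max_left _ _)
  refine ⟨S * C + Z.toReal, fun t ht t' ht' htt' => ?_⟩
  set d := dist t t' with hd
  have hd0 : 0 < d := dist_pos.2 htt'
  have hd1 : d ≤ 1 / 2 := by
    have := dist_triangle_right t t' x
    have := Metric.mem_ball.1 ht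
    have := Metric.mem_ball.1 ht'
    linarith
  have hpt : ∀ s, ‖kernel α L (t - s) * σ s ω - kernel α L (t' - s) * σ s ω‖ₑ ^ 2
      ≤ ENNReal.ofReal S * ‖kernel α L (t - s) - kernel α L (t' - s)‖ₑ ^ 2
        + ENNReal.ofReal (d ^ 2) * (φ s * ‖σ s ω‖ₑ ^ 2) := by
    intro s
    rw [← sub_mul, enorm_mul, mul_pow]
    by_cases hs : s ∈ Metric.closedBall c (M + 1)
    · refine le_trans ?_ le_self_add
      rw [mul_comm, enorm_sq_eq_ofReal (σ s ω)]
      exact mul_le_mul_left (ENNReal.ofReal_le_ofReal (hSb s hs)) _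
    · refine le_trans ?_ le_add_self
      rw [← mul_assoc]
      refine mul_le_mul_left ?_ _
      simp only [hφ]
      rw [enorm_sq_eq_ofReal, ← ENNReal.ofReal_mul (sq_nonneg d), ← mul_pow]
      refine ENNReal.ofReal_le_ofReal ?_
      have hsx : δ < ‖x - s‖ := by
        rw [Metric.mem_closedBall, not_le] at hs
        have := dist_triangle_left s c x
        rw [dist_eq_norm x s] at this
        linarith
      have hnt : ∀ z ∈ Metric.ball x R, ‖x - s‖ - R ≤ ‖z - s‖ := by
        intro z hz
        have h1 := Metric.mem_ball'.1 hz
        have h2 := dist_triangle x z s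
        rw [dist_eq_norm x s, dist_eq_norm z s] at h2
        linarith
      have h1 := hnt t ht
      have h2 := hnt t' ht'
      have key := hL.abs_profile_sub_le (by linarith) hanti hD (r := ‖x - s‖ - 1) (p := ‖t - s‖)
        (q := ‖t' - s‖) (by linarith) (by linarith) (by linarith) (by linarith)
      have hdist : |‖t - s‖ - ‖t' - s‖| ≤ d := by
        refine (abs_norm_sub_norm_le _ _).trans_eq ?_
        rw [sub_sub_sub_cancel_right, hd, dist_eq_norm]
      have key2 : |kernel α L (t - s) - kernel α L (t' - s)| ≤ d * ψ (‖x - s‖ - 1) := by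
        refine (key.trans (mul_le_mul_of_nonneg_left hdist (hnn _))).trans_eq (mul_comm _ _)
      exact sq_le_sq' (neg_le_of_abs_le key2) (le_of_abs_le key2)
  have hgm : Measurable fun s => ‖kernel α L (t - s) - kernel α L (t' - s)‖ₑ ^ 2 :=
    ((hL.measurable_kernel.comp (measurable_id.const_sub t)).sub
      (hL.measurable_kernel.comp (measurable_id.const_sub t'))).enorm.pow_const 2
  calc condVariance σ α L t t' ω
      ≤ ∫⁻ s, (ENNReal.ofReal S * ‖kernel α L (t - s) - kernel α L (t' - s)‖ₑ ^ 2
        + ENNReal.ofReal (d ^ 2) * (φ s * ‖σ s ω‖ₑ ^ 2)) := lintegral_mono hpt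
    _ = ENNReal.ofReal S * kernelIncrement α L (t - t') + ENNReal.ofReal (d ^ 2) * Z := by
        rw [lintegral_add_left (hgm.const_mul _), lintegral_const_mul' _ _ ENNReal.ofReal_ne_top,
          lintegral_const_mul' _ _ ENNReal.ofReal_ne_top, lintegral_kernel_sub]
    _ ≤ ENNReal.ofReal S * ENNReal.ofReal (C * d ^ (2 * γ))
        + ENNReal.ofReal (d ^ 2) * ENNReal.ofReal Z.toReal := by
        rw [ENNReal.ofReal_toReal hZω.ne]
        have := hle (t - t') (sub_ne_zero.2 htt') (by rwa [← dist_eq_norm])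
        rw [← dist_eq_norm] at this
        gcongr
    _ ≤ ENNReal.ofReal ((S * C + Z.toReal) * d ^ (2 * γ)) := by
        rw [← ENNReal.ofReal_mul hS0, ← ENNReal.ofReal_mul (sq_nonneg d),
          ← ENNReal.ofReal_add (by positivity) (by positivity)]
        refine ENNReal.ofReal_le_ofReal ?_
        -- The smooth outer part is of lower order, since `d < 1` and `γ < α + 1 < 1`.
        have : d ^ 2 ≤ d ^ (2 * γ) := by
          rw [← Real.rpow_natCast]
          exact Real.rpow_le_rpow_of_exponent_ge hd0 (by linarith) (by push_cast; linarith)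
        have h2 : d ^ 2 * Z.toReal ≤ d ^ (2 * γ) * Z.toReal := by gcongr
        linarith

/-- The moving average has a locally Hölder continuous version wherever each point lies in a ball
of radius `M + 1` on which the volatility is bounded. -/
theorem IsVMMA.exists_holder_version [IsProbabilityMeasure P]
    (hX : IsVMMA P W σ (kernel α L) X) (hL : KernelAssumptions α L M) (hW : IsWhiteNoise P W)
    (hσ : IsVolatility P σ) (hindep : IndepVolNoise P σ W) {U : Set Plane}
    (hU : ∀ x ∈ U, ∃ c, x ∈ Metric.ball c (M + 1) ∧
      AEBoundedOn P σ (Metric.closedBall c (M + 1))) {ε : ℝ} (hε : 0 < ε) (hεα : ε < α + 1) :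
    ∃ Y : Plane → Ω → ℝ, IsVersion P X Y ∧
      ∀ ω, LocallyHolderOn (α + 1 - ε) (fun t => Y t ω) U := by
  refine exists_version (by linarith) (fun t => (hX t).1)
    (fun t _ => hX.tendstoInMeasure hL hW hσ hindep t) fun x hx => ?_
  obtain ⟨c, hxc, hc⟩ := hU x hx
  -- An exponent strictly between the target `α + 1 - ε` and `α + 1`, leaving the room that the
  -- Kolmogorov argument consumes.
  obtain ⟨R, hR, hV⟩ := ae_condVariance_le hL hσ hc hxc (γ := α + 1 - ε / 2) (by linarith)
    (by linarith)
  refine ⟨R / 2, by linarith, ae_dyadicHolder (γ' := α + 1 - ε / 2) (by linarith) (by linarith)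
    (fun m => ⟨gaussMoment m, gaussMoment_ne_top m, fun t t' v ρ hv hρ => ?_⟩) hR hV⟩
  exact (hX.isStochasticIntegral_sub hL hW hσ t t').measure_le hσ.measurable_apply hW hindep
    (measurable_kernel_mul_sub hL hσ t t') m hv hρ

end MovingAverage

end VMMA

theorem theorem1 {Ω : Type*} [MeasurableSpace Ω] (P : Measure Ω) [IsProbabilityMeasure P]
    (W : Set VMMA.Plane → Ω → ℝ) (σ : VMMA.Plane → Ω → ℝ) (X : VMMA.Plane → Ω → ℝ)
    (α : ℝ) (L : ℝ → ℝ) (M : ℝ)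
    (hL : VMMA.KernelAssumptions α L M)
    (hW : VMMA.IsWhiteNoise P W)
    (hσ : VMMA.IsVolatility P σ)
    (hX : VMMA.IsVMMA P W σ (VMMA.kernel α L) X)
    (hindep : VMMA.IndepVolNoise P σ W) :
    -- (i) the variogram
    ((∃ c : ℝ, 0 < c ∧ ∀ x ∈ Ioc (0 : ℝ) 1, c ≤ L x) →
      ∃ V : ℝ → ℝ,
        (∀ t : VMMA.Plane, MemLp (fun ω => X 0 ω - X t ω) 2 P ∧
          ∫ ω, (X 0 ω - X t ω) ^ 2 ∂P = V ‖t‖) ∧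
        ∀ e : VMMA.Plane, ‖e‖ = 1 →
          Integrable (fun x : VMMA.Plane =>
            (‖x + (1 / 2 : ℝ) • e‖ ^ α - ‖x - (1 / 2 : ℝ) • e‖ ^ α) ^ 2) volume ∧
          Tendsto (fun h : ℝ => h ^ (-2 - 2 * α) * ((L h) ^ 2)⁻¹ * V h) (𝓝[>] 0)
            (𝓝 ((∫ ω, (σ 0 ω) ^ 2 ∂P) * ∫ x : VMMA.Plane,
              (‖x + (1 / 2 : ℝ) • e‖ ^ α - ‖x - (1 / 2 : ℝ) • e‖ ^ α) ^ 2))) ∧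
    -- (ii) Hölder continuity on a ball on which the volatility is bounded
    (∀ c : VMMA.Plane, VMMA.AEBoundedOn P σ (Metric.closedBall c (M + 1)) →
      ∀ ε : ℝ, 0 < ε → ε < α + 1 →
        ∃ Y : VMMA.Plane → Ω → ℝ, VMMA.IsVersion P X Y ∧
          ∀ ω, VMMA.LocallyHolderOn (α + 1 - ε) (fun t => Y t ω) (Metric.ball c (M + 1))) ∧
    -- (ii) Hölder continuity on the whole plane when the volatility is bounded on all such balls
    ((∀ c : VMMA.Plane, VMMA.AEBoundedOn P σ (Metric.closedBall c (M + 1))) →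
      ∀ ε : ℝ, 0 < ε → ε < α + 1 →
        ∃ Y : VMMA.Plane → Ω → ℝ, VMMA.IsVersion P X Y ∧
          ∀ ω, VMMA.LocallyHolderOn (α + 1 - ε) (fun t => Y t ω) Set.univ) := by
  refine ⟨fun hc => ?_, fun c hc ε hε hεα => ?_, fun h ε hε hεα => ?_⟩
  · set m := ∫ ω, (σ 0 ω) ^ 2 ∂P with hm
    -- The variogram is defined along one fixed direction; invariance under reflections transfers it
    -- to every `t` and every unit vector `e`.
    set e₀ : VMMA.Plane := EuclideanSpace.single 0 1 with he₀
    have he₀1 : ‖e₀‖ = 1 := by simp [he₀]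
    refine ⟨fun h => m * (VMMA.kernelIncrement α L (h • e₀)).toReal, fun t => ⟨?_, ?_⟩,
      fun e he => ?_⟩
    · exact (hX.isStochasticIntegral_sub hL hW hσ 0 t).memLp hσ.measurable_apply hW hindep
    · rw [hX.integral_sub_sq hL hW hσ hindep, VMMA.kernelIncrement_eq_of_norm_eq]
      rw [zero_sub, norm_neg, norm_smul, he₀1, mul_one, norm_norm]
    · obtain ⟨h1, h2⟩ := hL.tendsto_kernelIncrement hc he
      refine ⟨h1, (h2.const_mul m).congr fun h => ?_⟩
      rw [VMMA.kernelIncrement_eq_of_norm_eq (t := h • e) (t' := h • e₀)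
        (by rw [norm_smul, norm_smul, he, he₀1])]
      ring
  · exact hX.exists_holder_version hL hW hσ hindep (fun x hx => ⟨c, hx, hc⟩) hε hεα
  -- Each point is taken as the centre of its own ball.
  · exact hX.exists_holder_version hL hW hσ hindep
      (fun x _ => ⟨x, Metric.mem_ball_self (by linarith [hL.M_pos]), h x⟩) hε hεα
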